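/- **Model.** Time is counted for a classically controlled quantum program: basic arithmetic, comparison, memory access (also in superposition), drawing a random integer, preparing a state, reflecting about it and measuring each take time $O(1)$; a phase-oracle call for a Boolean function takes time proportional to the worst-case time of evaluating that function on an element of the domain. **Search and minimum finding.** For a Boolean function $f$ on $N\ge 1$ elements a *trial with range $m$* draws an integer $0\le j<m$ uniformly, runs Grover's algorithm with $j$ iterations, and checks the outcome. *BBHT* does trials with range $m=1,\tfrac87,(\tfrac87)^2,\dots$ while $m\le 2\sqrt N$, stopping at the first solution. *BCWZ* with parameter $\epsilon^{-1}$ sets $t_0=\min(\lceil\lg\epsilon^{-1}\rceil,N)$, does the exact search for $t=1,\dots,t_0$ solutions (amplitude amplification with an ancilla qubit that makes the success probability $1$ when there are exactly $t$ solutions) and then $3t_0$ trials with range $\sqrt{N/t_0}$, stopping at the first solution. *findsol* runs BBHT up to twice and then BCWZ. *minfind* with parameter $\epsilon^{-1}$ for a function $F$ picks $y$ uniformly at random, and repeatedly uses findsol with parameter $\epsilon^{-1}$ to replace $y$ by some $y'$ with $F(y')<F(y)$, returning $y$ when findsol finds nothing. (On an empty domain minfind finds nothing.) **Algorithm.** Let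 $V$ be an array of $C$ coin denominations (non-negative integers), $D\ge0$ an integer and $0<\epsilon<1$. *coinchange* keeps an array $T$ of size $D+1$, initially $T[0]=0$ and $T[i]=\infty$ for $i\ne0$. For $d=1,\dots,D$ it uses minfind with parameter $D\epsilon^{-1}$ to look for a coin $V[i]$ with $d-V[i]\ge 0$ for which $1+T[d-V[i]]$ is minimal (coins with $V[i]>d$ have value $\infty$), and if such a coin was found it sets $T[d]=1+T[d-V[i]]$. Finally it returns $T[D]$. **Theorem 11 (coinchange).** 1. With probability at least $1-\epsilon$, coinchange returns the minimum number of coins from $V$ (each denomination may be used any number of times) whose values sum to $D$, or $\infty$ if making $D$ is impossible. 2. There is an absolute constant $K>0$ such that, for $C\ge1$, $D\ge1$ and $D\epsilon^{-1}\ge2$, the expected running time of coinchange is at most $K\,D\sqrt{C\lg(D\epsilon^{-1})}$. 3. In particular, if $\epsilon^{-1}$ is polynomially bounded, the expected running time is $O(D\sqrt{C\lg D})$: for every $a\in\mathbb N$ there is a constant $K>0$, depending only on $a$, such that for $C\ge1$, $D\ge2$ and $\epsilon^{-1}\le D^a$ it is at most $K\,D\sqrt{C\lg D}$. -/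

import Mathlib

open scoped ENNReal

noncomputable section

/-! ### Classical evaluation with a step count -/

/-- The outcome of a classical computation: its value, and the number of basic operations
(memory accesses, additions, comparisons) it takes. Basic operations take unit time. -/
structure Timed (α : Type) where
  val : α
  cost : ℕ

/-- The time of one evaluation of `F` in superposition: the worst case over the domain. -/
def evalTime {ι α : Type} [Fintype ι] (F : ι → Timed α) : ℕ :=
  Finset.univ.sup fun i => (F i).cost

/-! ### Quantum circuits and quantum programs -/

/-- State vectors of a quantum register whose computational basis is `ι`. -/
abbrev QState (ι : Type) [Fintype ι] : Type := EuclideanSpace ℂ ι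

/-- The two gates of Grover-type search: the phase oracle of a Boolean function and the
reflection `2 |ψ⟩⟨ψ| - 1` about a state `ψ`. -/
inductive Gate (ι : Type) [Fintype ι] : Type
  | oracle (f : ι → Timed Bool) : Gate ι
  | reflect (ψ : QState ι) : Gate ι

/-- The unitary operator of a gate. The oracle maps `|i⟩` to `-|i⟩` if `f i` is true, and to `|i⟩`
otherwise. -/
def Gate.unitary {ι : Type} [Fintype ι] : Gate ι → (QState ι ≃ₗᵢ[ℂ] QState ι)
  | .oracle f => LinearIsometryEquiv.piLpCongrRight 2 fun i =>
      if (f i).val then LinearIsometryEquiv.neg ℂ else LinearIsometryEquiv.refl ℂ ℂ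
  | .reflect ψ => (Submodule.span ℂ {ψ}).reflection

/-- The time of a gate. An oracle gate computes `f`, applies the phase, and uncomputes `f`. -/
def Gate.cost {ι : Type} [Fintype ι] : Gate ι → ℕ
  | .oracle f => 2 * evalTime f + 1
  | .reflect _ => 1

/-- A circuit: an initial state and the gates to apply to it, first gate first; at the end the
register is measured in the computational basis. -/
structure Circuit (ι : Type) [Fintype ι] where
  init : QState ι
  norm_init : ‖init‖ = 1
  gates : List (Gate ι)

/-- The state before the measurement. -/
def Circuit.final {ι : Type} [Fintype ι] (c : Circuit ι) : QState ι :=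
  c.gates.foldl (fun φ g => g.unitary φ) c.init

theorem norm_foldl_gates {ι : Type} [Fintype ι] (gs : List (Gate ι)) (φ : QState ι) :
    ‖gs.foldl (fun φ g => g.unitary φ) φ‖ = ‖φ‖ := by
  induction gs generalizing φ with
  | nil => rfl
  | cons g gs ih => rw [List.foldl_cons, ih, LinearIsometryEquiv.norm_map]

theorem Circuit.sum_born {ι : Type} [Fintype ι] (c : Circuit ι) :
    ∑ i, ENNReal.ofReal (‖c.final i‖ ^ 2) = 1 := by
  rw [← ENNReal.ofReal_sum_of_nonneg fun i _ => sq_nonneg _, ← EuclideanSpace.norm_sq_eq,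
    Circuit.final, norm_foldl_gates, c.norm_init]
  simp

/-- The distribution of the measurement outcome (Born rule). -/
def Circuit.outcome {ι : Type} [Fintype ι] (c : Circuit ι) : PMF ι :=
  PMF.ofFintype (fun i => ENNReal.ofReal (‖c.final i‖ ^ 2)) c.sum_born

/-- The time of a circuit: preparation, gates, measurement. -/
def Circuit.cost {ι : Type} [Fintype ι] (c : Circuit ι) : ℕ :=
  (c.gates.map Gate.cost).sum + 2

/-- Classically controlled quantum programs that return an element of `α`. -/
inductive QProg (α : Type) : Type 1
  /-- stop and return `a` -/
  | ret (a : α) : QProg α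
  /-- perform `n` basic classical operations, then continue -/
  | step (n : ℕ) (k : QProg α) : QProg α
  /-- draw a uniformly random element of `{0, …, n - 1}` -/
  | toss (n : ℕ) (hn : 0 < n) (k : Fin n → QProg α) : QProg α
  /-- run a circuit and continue with the measured outcome -/
  | measure (ι : Type) [Fintype ι] (c : Circuit ι) (k : ι → QProg α) : QProg α

namespace QProg

/-- Sequential composition. -/
def bind {α β : Type} : QProg α → (α → QProg β) → QProg β
  | ret a, g => g a
  | step n k, g => step n (k.bind g)
  | toss n hn k, g => toss n hn fun j => (k j).bind g
  | measure ι c k, g => measure ι c fun i => (k i).bind g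

instance : Monad QProg where
  pure := ret
  bind := bind

/-- The joint distribution of the returned value and the running time of a program. -/
def run {α : Type} : QProg α → PMF (α × ℕ)
  | ret a => PMF.pure (a, 0)
  | step n k => k.run.map fun x => (x.1, x.2 + n)
  | toss n hn k =>
      haveI : Nonempty (Fin n) := ⟨⟨0, hn⟩⟩
      (PMF.uniformOfFintype (Fin n)).bind fun j => (k j).run.map fun x => (x.1, x.2 + 1)
  | measure _ c k => c.outcome.bind fun i => (k i).run.map fun x => (x.1, x.2 + c.cost)

/-- The distribution of the returned value. -/
def output {α : Type} (p : QProg α) : PMF α := p.run.map Prod.fst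

/-- The expected running time. -/
def expectedTime {α : Type} (p : QProg α) : ℝ≥0∞ := ∑' x, p.run x * (x.2 : ℝ≥0∞)

/-- `n` basic classical operations. -/
def tick (n : ℕ) : QProg Unit := step n (ret ())

end QProg

/-! ### Grover's algorithm -/

/-- The list of gates of `j` Grover iterations. -/
def groverGates {ι : Type} [Fintype ι] (ψ : QState ι) (f : ι → Timed Bool) (j : ℕ) :
    List (Gate ι) :=
  (List.replicate j [Gate.oracle f, Gate.reflect ψ]).flatten

/-- The uniform superposition of `N` basis states. -/
def uniformState (N : ℕ) : QState (Fin N) := WithLp.toLp 2 fun _ => ((1 / √N : ℝ) : ℂ)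

theorem norm_uniformState (N : ℕ) [NeZero N] : ‖uniformState N‖ = 1 := by
  have hN : (N : ℝ) ≠ 0 := Nat.cast_ne_zero.mpr (NeZero.ne N)
  have h : ‖uniformState N‖ ^ 2 = 1 := by
    rw [EuclideanSpace.norm_sq_eq]
    simp only [uniformState, Complex.norm_real, Real.norm_eq_abs, sq_abs, div_pow, one_pow,
      Finset.sum_const, Finset.card_univ, Fintype.card_fin, nsmul_eq_mul]
    rw [Real.sq_sqrt (Nat.cast_nonneg N)]
    field_simp
  nlinarith [norm_nonneg (uniformState N)]

/-- Grover's algorithm with `j` iterations for the Boolean function `f`. -/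
def grover {N : ℕ} [NeZero N] (f : Fin N → Timed Bool) (j : ℕ) : QProg (Fin N) :=
  .measure (Fin N) ⟨uniformState N, norm_uniformState N, groverGates (uniformState N) f j⟩ .ret

/-- Evaluate `f i` classically and return `i` if it is a solution. -/
def verify {N : ℕ} (f : Fin N → Timed Bool) (i : Fin N) : QProg (Option (Fin N)) := do
  QProg.tick (f i).cost
  return if (f i).val then some i else none

/-- One trial of quantum search: choose an integer `0 ≤ j < m` uniformly at random, execute Grover's
algorithm with `j` iterations, and check the outcome. -/
def groverTrial {N : ℕ} [NeZero N] (f : Fin N → Timed Bool) (m : ℝ) (hm : 0 < m) :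
    QProg (Option (Fin N)) := do
  QProg.tick 1
  let j ← QProg.toss ⌈m⌉₊ (Nat.ceil_pos.mpr hm) QProg.ret
  let i ← grover f j
  verify f i

/-- `p` is run; if it returns no solution, then `q` is run. -/
def QProg.orElseRun {α : Type} (p q : QProg (Option α)) : QProg (Option α) := do
  match ← p with
  | some a => return some a
  | none => q

/-! ### Search with an unknown number of solutions -/

/-- The number of `m` in the sequence `1, 8/7, (8/7)², …` with `m ≤ 2√N`. -/
def bbhtRounds (N : ℕ) : ℕ := ⌊Real.logb (8 / 7) (2 * √N)⌋₊ + 1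

theorem lt_bbhtRounds_iff {N : ℕ} (hN : 0 < N) (k : ℕ) :
    k < bbhtRounds N ↔ (8 / 7 : ℝ) ^ k ≤ 2 * √N := by
  have h1 : (1 : ℝ) ≤ √N := Real.one_le_sqrt.mpr (by exact_mod_cast hN)
  rw [bbhtRounds, Nat.lt_succ_iff,
    Nat.le_floor_iff (Real.logb_nonneg (by norm_num) (by linarith)),
    Real.le_logb_iff_rpow_le (by norm_num) (by linarith), Real.rpow_natCast]

/-- The rounds of BBHT from `m = (8/7)^k` on, `n` of them. -/
def bbhtLoop {N : ℕ} [NeZero N] (f : Fin N → Timed Bool) : (n k : ℕ) → QProg (Option (Fin N))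
  | 0, _ => return none
  | n + 1, k =>
      (groverTrial f ((8 / 7 : ℝ) ^ k) (by positivity)).orElseRun (bbhtLoop f n (k + 1))

/-- BBHT: start with `m = 1`; while `m ≤ 2√N`, do a search trial with `0 ≤ j < m`, return a solution
if one is found, and otherwise replace `m` by `8/7 * m`. -/
def bbht {N : ℕ} [NeZero N] (f : Fin N → Timed Bool) : QProg (Option (Fin N)) :=
  bbhtLoop f (bbhtRounds N) 0

/-- `arcsin √(t/N)`, the Grover angle for `t` solutions among `N` elements. -/
def groverAngle (N t : ℕ) : ℝ := Real.arcsin √((t : ℝ) / N)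

/-- The number of iterations of exact search. -/
def exactIter (N t : ℕ) : ℕ := ⌈Real.pi / (4 * groverAngle N t) - 1 / 2⌉₊

/-- The angle of the ancilla qubit of exact search: it lowers the Grover angle `θ` to
`π / (2 (2 j + 1))`, where `j` is the number of iterations. -/
def exactAncilla (N t : ℕ) : ℝ :=
  Real.arcsin
    (Real.sin (Real.pi / (2 * (2 * exactIter N t + 1))) / Real.sin (groverAngle N t))

/-- The uniform superposition of `N` basis states, tensored with `cos β |0⟩ + sin β |1⟩`. -/
def tiltedState (N : ℕ) (β : ℝ) : QState (Fin N × Bool) :=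
  WithLp.toLp 2 fun x => ((1 / √N * (if x.2 then Real.sin β else Real.cos β) : ℝ) : ℂ)

theorem norm_tiltedState (N : ℕ) [NeZero N] (β : ℝ) : ‖tiltedState N β‖ = 1 := by
  have hN : (N : ℝ) ≠ 0 := Nat.cast_ne_zero.mpr (NeZero.ne N)
  have h : ‖tiltedState N β‖ ^ 2 = 1 := by
    rw [EuclideanSpace.norm_sq_eq]
    simp only [tiltedState, Complex.norm_real, Real.norm_eq_abs, sq_abs, Fintype.sum_prod_type,
      Fintype.sum_bool, mul_pow, div_pow, one_pow, if_true, Finset.sum_const, Finset.card_univ,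
      Fintype.card_fin, nsmul_eq_mul, Bool.false_eq_true, if_false]
    rw [Real.sq_sqrt (Nat.cast_nonneg N), ← mul_add, Real.sin_sq_add_cos_sq]
    field_simp
  nlinarith [norm_nonneg (tiltedState N β)]

/-- Exact search for functions with exactly `t` solutions: amplitude amplification in which an
ancilla qubit lowers the initial success probability so that a whole number of iterations reaches
success probability one. The outcome is checked. -/
def exactSearch {N : ℕ} [NeZero N] (f : Fin N → Timed Bool) (t : ℕ) :
    QProg (Option (Fin N)) := do
  QProg.tick 1
  let x ← QProg.measure (Fin N × Bool)
    ⟨tiltedState N (exactAncilla N t), norm_tiltedState N _,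
      groverGates (tiltedState N (exactAncilla N t))
        (fun x => ⟨(f x.1).val && x.2, (f x.1).cost + 1⟩) (exactIter N t)⟩ QProg.ret
  verify f x.1

/-- Exact searches for `n`, `n + 1`, …, up to `r` values of the number of solutions. -/
def exactLoop {N : ℕ} [NeZero N] (f : Fin N → Timed Bool) : (r n : ℕ) → QProg (Option (Fin N))
  | 0, _ => return none
  | r + 1, n => (exactSearch f n).orElseRun (exactLoop f r (n + 1))

/-- Up to `r` search trials with a fixed range `0 ≤ j < m`. -/
def trialLoop {N : ℕ} [NeZero N] (f : Fin N → Timed Bool) (m : ℝ) (hm : 0 < m) :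
    (r : ℕ) → QProg (Option (Fin N))
  | 0 => return none
  | r + 1 => (groverTrial f m hm).orElseRun (trialLoop f m hm r)

/-- The threshold `⌈lg ε⁻¹⌉` of BCWZ, capped at `N`. -/
def bcwzThreshold (N : ℕ) (εinv : ℝ) : ℕ := min ⌈Real.logb 2 εinv⌉₊ N

/-- BCWZ, the search of Buhrman, Cleve, de Wolf and Zalka with small error. With `t₀` as above:
exact searches for `1, …, t₀` solutions, and, if these find nothing, `3 t₀` trials with at most
about `√(N / t₀)` Grover iterations each. -/
def bcwz {N : ℕ} [NeZero N] (f : Fin N → Timed Bool) (εinv : ℝ) : QProg (Option (Fin N)) :=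
  let t₀ := bcwzThreshold N εinv
  (exactLoop f t₀ 1).orElseRun
    (if h : 0 < t₀ then
      trialLoop f (√((N : ℝ) / t₀))
        (Real.sqrt_pos.mpr (div_pos (Nat.cast_pos.mpr (NeZero.pos N)) (Nat.cast_pos.mpr h)))
        (3 * t₀)
    else return none)

/-- findsol: run BBHT up to twice, then BCWZ with parameter `ε⁻¹`; return the first solution. -/
def findsol {N : ℕ} [NeZero N] (f : Fin N → Timed Bool) (εinv : ℝ) : QProg (Option (Fin N)) :=
  (bbht f).orElseRun ((bbht f).orElseRun (bcwz f εinv))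

/-! ### Minimum finding -/

/-- The Boolean function `y' ↦ (F y' < v)`. -/
def isBelow {N : ℕ} {κ : Type} [LinearOrder κ] (F : Fin N → Timed κ) (v : κ) :
    Fin N → Timed Bool :=
  fun y' => ⟨decide ((F y').val < v), (F y').cost + 1⟩

/-- The loop of minfind: evaluate `F y`, search for `y'` with `F y' < F y`, and continue with it or,
if none is found, return `y`. As `F y` decreases strictly, at most `N` passes are possible, and
the bound `n` on the number of passes is never met if it starts at `N`. -/
def minfindLoop {N : ℕ} [NeZero N] {κ : Type} [LinearOrder κ] (F : Fin N → Timed κ) (εinv : ℝ) :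
    (n : ℕ) → Fin N → QProg (Fin N)
  | 0, y => return y
  | n + 1, y => do
      QProg.tick ((F y).cost + 1)
      match ← findsol (isBelow F (F y).val) εinv with
      | some y' => minfindLoop F εinv n y'
      | none => return y

/-- minfind with parameter `ε⁻¹`: pick `y` uniformly at random and run the loop. On an empty domain
it returns `none`. -/
def minfind {N : ℕ} {κ : Type} [LinearOrder κ] (F : Fin N → Timed κ) (εinv : ℝ) :
    QProg (Option (Fin N)) := do
  QProg.tick 1
  if h : N = 0 then return none
  else
    have : NeZero N := ⟨h⟩
    let y ← QProg.toss N (Nat.pos_of_ne_zero h) QProg.ret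
    let y' ← minfindLoop F εinv N y
    return some y'

/-! ### The coin changer -/

/-- The minimum number of coins with denominations `V` that make `D` units, `⊤` if impossible;
`c i` is the number of coins of the `i`-th denomination. -/
def minCoins {C : ℕ} (V : Fin C → ℕ) (D : ℕ) : ℕ∞ :=
  ⨅ (c : Fin C → ℕ) (_ : ∑ i, c i * V i = D), ((∑ i, c i : ℕ) : ℕ∞)

/-- The function that is minimized for the entry `d`: `1 + T[d - V[i]]` if `d - V[i] ≥ 0`, and `∞` for
coins that are too large. It reads `V[i]` and compares it with `d`; for a usable coin it then
subtracts, reads `T`, and adds. -/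
def coinValue {C : ℕ} (V : Fin C → ℕ) (T : ℕ → ℕ∞) (d : ℕ) (i : Fin C) : Timed ℕ∞ :=
  if V i ≤ d then ⟨1 + T (d - V i), 5⟩ else ⟨⊤, 2⟩

/-- The table after the entries `1, …, d` have been processed; `D + 1` is its size, and the cells
`0, …, D` of the array are the only ones used. -/
def coinTable {C : ℕ} (V : Fin C → ℕ) (D : ℕ) (εinv : ℝ) : ℕ → QProg (ℕ → ℕ∞)
  | 0 => do
      QProg.tick (D + 1)
      return fun j => if j = 0 then 0 else ⊤
  | d + 1 => do
      let T ← coinTable V D εinv d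
      QProg.tick 1
      match ← minfind (coinValue V T (d + 1)) εinv with
      | none => return T
      | some i =>
          QProg.tick 6
          return if V i ≤ d + 1 then Function.update T (d + 1) (1 + T (d + 1 - V i)) else T

/-- coinchange with desired failure probability `ε`: fill in the table for `d = 1, …, D`, where each
call to minfind gets the parameter `D ε⁻¹`, and return `T[D]`. -/
def coinchange {C : ℕ} (V : Fin C → ℕ) (D : ℕ) (ε : ℝ) : QProg ℕ∞ := do
  let T ← coinTable V D (D * ε⁻¹) D
  QProg.tick 1
  return T D

end

/-! Two real functionals, defined by recursion on programs, carry the proof: `QProg.ev`, the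
expectation of a function of the result, and `QProg.time`, the expected cost. Both behave well under
composition, and `QProg.tsum_run` ties them to the actual distribution.

Every search procedure is symmetric: it reports all solutions with equal probability and otherwise
reports nothing, with some probability δ. This is `IsSearch`, stable under "else run". With t > 0
solutions among N, a trial of range at least √(N/t) fails with probability at most 3/4. As 3/4 · 8/7
< 1, BBHT takes expected time O(√(N/t)); as 3/4 · (8/7)² < 1, it fails with probability O(1/t). BCWZ
fails with probability at most ε in time O(√(N lg ε⁻¹)). Two BBHT runs before BCWZ therefore push
the failure of findsol down to ε/(2t²), while BCWZ is reached too rarely to spoil the factor 1/√t in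
the time.

For minfind, let t be the number of elements below the current one. A successful pass moves to a
uniformly random one of these t elements. Since 1/(2t²) ≤ 1/t - 1/(t+1), the failures of all passes
telescope to at most ε t/(t+1) (`minfindLoop_failure`), so ε need not be divided by the number of
passes. For the time, the potential 5 - 4/√(t+1) drops on average by at least 1/√t per successful
pass, which pays for the search (`time_minfindLoop`). Hence a minimum is missed with probability at
most ε, in expected time O(√(N lg ε⁻¹)).

The coin changer is dynamic programming (`IsTable.minCoins_succ`) with one minfind per entry; a
union bound over D calls of error ε/D gives correctness, and the times add up. -/

namespace QProg

/-! ### Real-valued expectation and expected time of programs. -/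

/-- The expectation of `φ` at the value returned by a program. -/
noncomputable def ev {α : Type} : QProg α → (α → ℝ) → ℝ
  | ret a, φ => φ a
  | step _ k, φ => k.ev φ
  | toss n _ k, φ => (∑ j, (k j).ev φ) / n
  | measure _ c k, φ => ∑ i, ‖c.final i‖ ^ 2 * (k i).ev φ

/-- The expected running time of a program as a real number. -/
noncomputable def time {α : Type} : QProg α → ℝ
  | ret _ => 0
  | step n k => n + k.time
  | toss n _ k => 1 + (∑ j, (k j).time) / n
  | measure _ c k => c.cost + ∑ i, ‖c.final i‖ ^ 2 * (k i).time

end QProg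

theorem Circuit.sum_norm_sq {ι : Type} [Fintype ι] (c : Circuit ι) :
    ∑ i, ‖c.final i‖ ^ 2 = 1 := by
  rw [← EuclideanSpace.norm_sq_eq, Circuit.final, norm_foldl_gates, c.norm_init, one_pow]

namespace QProg

variable {α β : Type}

theorem ev_bind (p : QProg α) (g : α → QProg β) (φ : β → ℝ) :
    (p.bind g).ev φ = p.ev fun a => (g a).ev φ := by
  induction p with
  | ret a => rfl
  | step n k ih => simpa [bind, ev] using ih
  | toss n hn k ih => simp [bind, ev, ih]
  | measure ι c k ih => simp [bind, ev, ih]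

theorem ev_add (p : QProg α) (φ χ : α → ℝ) :
    p.ev (fun a => φ a + χ a) = p.ev φ + p.ev χ := by
  induction p with
  | ret a => rfl
  | step n k ih => simpa [ev] using ih
  | toss n hn k ih => simp [ev, ih, Finset.sum_add_distrib, add_div]
  | measure ι c k ih => simp [ev, ih, Finset.sum_add_distrib, mul_add]

theorem ev_const (p : QProg α) (x : ℝ) : (p.ev fun _ => x) = x := by
  induction p with
  | ret a => rfl
  | step n k ih => simpa [ev] using ih
  | toss n hn k ih =>
    have : (n : ℝ) ≠ 0 := by positivity
    simp [ev, ih]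
    field_simp
  | measure ι c k ih => simp [ev, ih, ← Finset.sum_mul, c.sum_norm_sq]

theorem ev_mono (p : QProg α) {φ χ : α → ℝ} (h : ∀ a, φ a ≤ χ a) : p.ev φ ≤ p.ev χ := by
  induction p with
  | ret a => exact h a
  | step n k ih => exact ih
  | toss n hn k ih =>
    simp only [ev]
    gcongr with j
    exact ih j
  | measure ι c k ih =>
    simp only [ev]
    gcongr with j
    exact ih j

theorem ev_nonneg (p : QProg α) {φ : α → ℝ} (h : ∀ a, 0 ≤ φ a) : 0 ≤ p.ev φ := by
  simpa [ev_const] using p.ev_mono (φ := fun _ => 0) h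

theorem ev_le (p : QProg α) {φ : α → ℝ} {x : ℝ} (h : ∀ a, φ a ≤ x) : p.ev φ ≤ x := by
  simpa [ev_const] using p.ev_mono (χ := fun _ => x) h

theorem time_nonneg (p : QProg α) : 0 ≤ p.time := by
  induction p with
  | ret a => exact le_rfl
  | step n k ih => simp only [time]; positivity
  | toss n hn k ih =>
    have := Finset.sum_nonneg fun j (_ : j ∈ Finset.univ) => ih j
    simp only [time]; positivity
  | measure ι c k ih =>
    have := Finset.sum_nonneg fun j (_ : j ∈ Finset.univ) =>
      mul_nonneg (sq_nonneg ‖c.final j‖) (ih j)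
    simp only [time]; positivity

theorem time_bind (p : QProg α) (g : α → QProg β) :
    (p.bind g).time = p.time + p.ev fun a => (g a).time := by
  induction p with
  | ret a => simp [bind, time, ev]
  | step n k ih => simp [bind, time, ev, ih, add_assoc]
  | toss n hn k ih => simp [bind, time, ev, ih, Finset.sum_add_distrib, add_div, add_assoc]
  | measure ι c k ih =>
    simp [bind, time, ev, ih, Finset.sum_add_distrib, mul_add, add_assoc]

theorem time_bind_le {p : QProg α} {g : α → QProg β} {x y : ℝ} (hp : p.time ≤ x)
    (hg : ∀ a, (g a).time ≤ y) : (p.bind g).time ≤ x + y := by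
  rw [time_bind]
  exact add_le_add hp (p.ev_le hg)

@[simp] theorem bind_eq (p : QProg α) (g : α → QProg β) : p >>= g = p.bind g := rfl

@[simp] theorem pure_eq (a : α) : (Pure.pure a : QProg α) = ret a := rfl

@[simp] theorem ev_tick_bind (n : ℕ) (g : Unit → QProg β) (φ : β → ℝ) :
    ((tick n).bind g).ev φ = (g ()).ev φ := rfl

@[simp] theorem time_tick_bind (n : ℕ) (g : Unit → QProg β) :
    ((tick n).bind g).time = n + (g ()).time := rfl

@[simp] theorem ev_ret (a : α) (φ : α → ℝ) : (ret a).ev φ = φ a := rfl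

@[simp] theorem time_ret (a : α) : (ret a).time = 0 := rfl

end QProg

/-! ### Comparison with the distribution of a run. -/

theorem PMF.tsum_bind_mul {α β : Type} (p : PMF α) (g : α → PMF β) (h : β → ℝ≥0∞) :
    ∑' b, (p.bind g) b * h b = ∑' a, p a * ∑' b, g a b * h b := by
  simp_rw [PMF.bind_apply, ← ENNReal.tsum_mul_right, ← ENNReal.tsum_mul_left]
  rw [ENNReal.tsum_comm]
  simp_rw [mul_assoc]

theorem PMF.tsum_pure_mul {β : Type} (b : β) (h : β → ℝ≥0∞) :
    ∑' x, (PMF.pure b) x * h x = h b := by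
  rw [tsum_eq_single b (by intro x hx; simp [PMF.pure_apply, hx])]
  simp

theorem PMF.tsum_map_mul {α β : Type} (p : PMF α) (g : α → β) (h : β → ℝ≥0∞) :
    ∑' b, (p.map g) b * h b = ∑' a, p a * h (g a) := by
  simp_rw [← PMF.bind_pure_comp, PMF.tsum_bind_mul, Function.comp, PMF.tsum_pure_mul]

namespace QProg

variable {α : Type}

/-- A delay of `n` steps is absorbed into the test function, as the constant `c * n`; this is why
`tsum_run` is proved for all `φ` at once. -/
theorem tsum_run_add (q : QProg α) (c : ℝ) (hc : 0 ≤ c)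
    (ih : ∀ φ : α → ℝ, (∀ a, 0 ≤ φ a) → ∑' x, q.run x * ENNReal.ofReal (φ x.1 + c * x.2) =
      ENNReal.ofReal (q.ev φ + c * q.time))
    (φ : α → ℝ) (hφ : ∀ a, 0 ≤ φ a) (n : ℕ) :
    ∑' x, (q.run.map fun x => (x.1, x.2 + n)) x * ENNReal.ofReal (φ x.1 + c * x.2) =
      ENNReal.ofReal (q.ev φ + c * (n + q.time)) := by
  rw [PMF.tsum_map_mul]
  have h := ih (fun a => φ a + c * n) fun a => add_nonneg (hφ a) (by positivity)
  rw [ev_add, ev_const] at h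
  rw [show q.ev φ + c * (n + q.time) = q.ev φ + c * n + c * q.time by ring, ← h]
  congr! 4 with x
  push_cast
  ring

/-- One induction serves both uses: `c = 1`, `φ = 0` gives the expected time, and `c = 0` with an
indicator `φ` gives output probabilities. -/
theorem tsum_run (p : QProg α) (c : ℝ) (hc : 0 ≤ c) (φ : α → ℝ) (hφ : ∀ a, 0 ≤ φ a) :
    ∑' x, p.run x * ENNReal.ofReal (φ x.1 + c * x.2) =
      ENNReal.ofReal (p.ev φ + c * p.time) := by
  induction p generalizing φ with
  | ret a => simp [run]
  | step n k ih => exact tsum_run_add k c hc ih φ hφ n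
  | toss n hn k ih =>
    have hn' : (0 : ℝ) < n := Nat.cast_pos.mpr hn
    have : Nonempty (Fin n) := ⟨⟨0, hn⟩⟩
    rw [run, PMF.tsum_bind_mul, tsum_fintype]
    have h0 : ∀ j, 0 ≤ (k j).ev φ + c * ((1 : ℕ) + (k j).time) := fun j =>
      add_nonneg ((k j).ev_nonneg hφ)
        (mul_nonneg hc (add_nonneg (Nat.cast_nonneg _) (k j).time_nonneg))
    simp_rw [fun j => tsum_run_add (k j) c hc (ih j) φ hφ 1, PMF.uniformOfFintype_apply,
      Fintype.card_fin]
    rw [← Finset.mul_sum, ← ENNReal.ofReal_sum_of_nonneg fun j _ => h0 j,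
      ← ENNReal.ofReal_natCast n, ← ENNReal.ofReal_inv_of_pos hn',
      ← ENNReal.ofReal_mul (by positivity)]
    congr 1
    simp only [ev, time, Finset.sum_add_distrib, ← Finset.mul_sum, Finset.sum_const,
      Finset.card_univ, Fintype.card_fin, nsmul_eq_mul, Nat.cast_one]
    field_simp
  | measure ι d k ih =>
    rw [run, PMF.tsum_bind_mul, tsum_fintype]
    have h0 : ∀ j, 0 ≤ (k j).ev φ + c * (d.cost + (k j).time) := fun j =>
      add_nonneg ((k j).ev_nonneg hφ)
        (mul_nonneg hc (add_nonneg (Nat.cast_nonneg _) (k j).time_nonneg))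
    simp_rw [fun j => tsum_run_add (k j) c hc (ih j) φ hφ d.cost]
    simp only [Circuit.outcome, PMF.ofFintype_apply]
    simp_rw [← ENNReal.ofReal_mul (sq_nonneg _)]
    rw [← ENNReal.ofReal_sum_of_nonneg fun j _ => mul_nonneg (sq_nonneg _) (h0 j)]
    congr 1
    simp only [ev, time, mul_add, Finset.sum_add_distrib, ← Finset.sum_mul, d.sum_norm_sq]
    rw [Finset.mul_sum]
    simp only [one_mul, mul_left_comm c]

theorem expectedTime_eq (p : QProg α) : p.expectedTime = ENNReal.ofReal p.time := by
  simpa [expectedTime, ev_const] using p.tsum_run 1 zero_le_one (fun _ => 0) fun _ => le_rfl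

open Classical in
theorem output_apply (p : QProg α) (a : α) :
    p.output a = ENNReal.ofReal (p.ev fun x => if x = a then 1 else 0) := by
  have h := p.tsum_run 0 le_rfl (fun x => if x = a then 1 else 0) fun x => by split_ifs <;> simp
  simp only [zero_mul, add_zero] at h
  rw [← h, output, PMF.map_apply]
  congr! 2 with x
  by_cases hx : x.1 = a
  · simp [hx]
  · simp [hx, Ne.symm hx]

end QProg

/-! ### Amplitudes after Grover iterations. -/

/-- The factors by which `j` Grover iterations scale the amplitudes of the good and the bad basis
states when the initial probability of the good ones is `p`. -/
noncomputable def groverFactor (p : ℝ) : ℕ → ℝ × ℝ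
  | 0 => (1, 1)
  | j + 1 =>
      ((groverFactor p j).1 * (1 - 2 * p) + 2 * (groverFactor p j).2 * (1 - p),
        (groverFactor p j).2 * (1 - 2 * p) - 2 * (groverFactor p j).1 * p)

/-- An iteration rotates by 2θ in the plane of the good and bad parts. Multiplying by sin θ and cos
θ instead of dividing keeps the degenerate cases p = 0 and p = 1. -/
theorem groverFactor_sin_cos (θ : ℝ) (j : ℕ) :
    (groverFactor (Real.sin θ ^ 2) j).1 * Real.sin θ = Real.sin ((2 * j + 1) * θ) ∧
      (groverFactor (Real.sin θ ^ 2) j).2 * Real.cos θ = Real.cos ((2 * j + 1) * θ) := by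
  induction j with
  | zero => simp [groverFactor]
  | succ j ih =>
    have h : (2 * ((j + 1 : ℕ) : ℝ) + 1) * θ = (2 * j + 1) * θ + 2 * θ := by push_cast; ring
    rw [h, Real.sin_add, Real.cos_add, ← ih.1, ← ih.2, Real.sin_two_mul, Real.cos_two_mul]
    have hc := Real.cos_sq' θ
    constructor
    · simp only [groverFactor]
      rw [hc]
      linear_combination (-2 * (groverFactor (Real.sin θ ^ 2) j).2 * Real.sin θ) * hc
    · simp only [groverFactor]
      rw [hc]
      ring

/-- Oracle and reflection preserve the span of the good and bad parts of `ψ`, so two factors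
describe the state. A general `ψ` covers both plain Grover search and the ancilla version. -/
theorem final_grover {ι : Type} [Fintype ι] (ψ : QState ι) (hψ : ‖ψ‖ = 1) (f : ι → Timed Bool)
    (p : ℝ) (hp : ∑ i with (f i).val, ‖ψ i‖ ^ 2 = p) (j : ℕ) (i : ι) :
    ((groverGates ψ f j).foldl (fun φ g => g.unitary φ) ψ) i =
      ((if (f i).val then (groverFactor p j).1 else (groverFactor p j).2 : ℝ) : ℂ) * ψ i := by
  induction j generalizing i with
  | zero => simp [groverGates, groverFactor]
  | succ j ih =>
    have hfold : (groverGates ψ f (j + 1)).foldl (fun φ g => g.unitary φ) ψ =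
        (Gate.reflect ψ).unitary ((Gate.oracle f).unitary
          ((groverGates ψ f j).foldl (fun φ g => g.unitary φ) ψ)) := by
      simp [groverGates, List.replicate_succ']
    rw [hfold]
    generalize (groverGates ψ f j).foldl (fun φ g => g.unitary φ) ψ = χ at ih
    have hq : ∑ i with ¬ (f i).val, ‖ψ i‖ ^ 2 = 1 - p := by
      have h := Finset.sum_filter_add_sum_filter_not Finset.univ
        (fun i => (f i).val = true) fun i => ‖ψ i‖ ^ 2
      rw [hp, ← EuclideanSpace.norm_sq_eq, hψ] at h
      linarith
    have horacle : ∀ i, (Gate.oracle f).unitary χ i =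
        ((if (f i).val then -(groverFactor p j).1 else (groverFactor p j).2 : ℝ) : ℂ) * ψ i := by
      intro i
      simp only [Gate.unitary, LinearIsometryEquiv.piLpCongrRight_apply]
      by_cases h : (f i).val <;> simp [h, ih]
    generalize (Gate.oracle f).unitary χ = ω at horacle
    have hinner : ∀ a b : ℝ, (∀ i, ω i = ((if (f i).val then -a else b : ℝ) : ℂ) * ψ i) →
        inner ℂ ψ ω = ((-a * p + b * (1 - p) : ℝ) : ℂ) := by
      intro a b hab
      rw [PiLp.inner_apply, ← hq, ← hp, Finset.mul_sum, Finset.mul_sum,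
        Finset.sum_filter, Finset.sum_filter (fun i => ¬ (f i).val = true),
        ← Finset.sum_add_distrib, Complex.ofReal_sum]
      refine Finset.sum_congr rfl fun i _ => ?_
      rw [hab, RCLike.inner_apply, mul_assoc, ← RCLike.star_def, Complex.star_def,
        Complex.mul_conj, Complex.normSq_eq_norm_sq]
      by_cases h : (f i).val <;> simp [h]
    rw [Gate.unitary, Submodule.reflection_apply, Submodule.starProjection_unit_singleton ℂ hψ,
      hinner _ _ horacle]
    simp only [PiLp.sub_apply, PiLp.smul_apply, horacle, groverFactor, nsmul_eq_mul, smul_eq_mul]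
    by_cases h : (f i).val <;> simp [h] <;> ring

/-! ### Symmetric searches and their composition. -/

/-- The solutions of a search problem. -/
def solutions {N : ℕ} (f : Fin N → Timed Bool) : Finset (Fin N) :=
  Finset.univ.filter fun i => (f i).val = true

theorem cost_le_evalTime {ι α : Type} [Fintype ι] (F : ι → Timed α) (i : ι) :
    (F i).cost ≤ evalTime F :=
  Finset.le_sup (f := fun i => (F i).cost) (Finset.mem_univ i)

theorem sum_cost_groverGates {ι : Type} [Fintype ι] (ψ : QState ι) (f : ι → Timed Bool) (j : ℕ) :
    ((groverGates ψ f j).map Gate.cost).sum = j * (2 * evalTime f + 2) := by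
  induction j with
  | zero => simp [groverGates]
  | succ j ih =>
    simp only [groverGates] at ih ⊢
    simp only [List.replicate_succ, List.flatten_cons, List.map_append, List.sum_append, ih]
    simp [Gate.cost]
    ring

/-- The program `q` returns each element of `S` with the same probability, no element outside `S`,
and `none` with probability `δ`. -/
structure IsSearch {N : ℕ} (q : QProg (Option (Fin N))) (S : Finset (Fin N)) (δ : ℝ) : Prop where
  nonneg : 0 ≤ δ
  ev_eq : ∃ r, 0 ≤ r ∧ δ + r * S.card = 1 ∧
    ∀ φ : Option (Fin N) → ℝ, q.ev φ = δ * φ none + r * ∑ i ∈ S, φ (some i)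

namespace IsSearch

variable {N : ℕ} {S : Finset (Fin N)}

theorem le_one {q : QProg (Option (Fin N))} {δ : ℝ} (h : IsSearch q S δ) : δ ≤ 1 := by
  obtain ⟨r, hr, h1, -⟩ := h.ev_eq
  have : 0 ≤ r * S.card := by positivity
  linarith

theorem of_forall {q : QProg (Option (Fin N))} {δ r : ℝ} (hδ : 0 ≤ δ) (hr : 0 ≤ r)
    (h : ∀ φ : Option (Fin N) → ℝ, q.ev φ = δ * φ none + r * ∑ i ∈ S, φ (some i)) :
    IsSearch q S δ := by
  refine ⟨hδ, r, hr, ?_, h⟩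
  have := h fun _ => 1
  simpa [QProg.ev_const] using this.symm

theorem ret_none : IsSearch (QProg.ret (none : Option (Fin N))) S 1 :=
  of_forall zero_le_one le_rfl fun φ => by simp

theorem ev_orElseRun (p q : QProg (Option (Fin N))) (φ : Option (Fin N) → ℝ) :
    (p.orElseRun q).ev φ = p.ev fun o => o.elim (q.ev φ) fun a => φ (some a) := by
  rw [QProg.orElseRun, QProg.bind_eq, QProg.ev_bind]
  congr 1
  ext o
  cases o <;> rfl

theorem orElseRun {p q : QProg (Option (Fin N))} {δ η : ℝ} (hp : IsSearch p S δ)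
    (hq : IsSearch q S η) : IsSearch (p.orElseRun q) S (δ * η) := by
  obtain ⟨r, hr, -, h⟩ := hp.ev_eq
  obtain ⟨s, hs, -, h'⟩ := hq.ev_eq
  refine of_forall (r := r + δ * s) (mul_nonneg hp.nonneg hq.nonneg)
    (add_nonneg hr (mul_nonneg hp.nonneg hs)) fun φ => ?_
  rw [ev_orElseRun, h]
  simp only [Option.elim, h']
  ring

/-- The second program is charged only with the failure probability of the first. -/
theorem time_orElseRun {p : QProg (Option (Fin N))} {δ : ℝ} (hp : IsSearch p S δ)
    (q : QProg (Option (Fin N))) : (p.orElseRun q).time = p.time + δ * q.time := by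
  obtain ⟨r, hr, -, h⟩ := hp.ev_eq
  rw [QProg.orElseRun, QProg.bind_eq, QProg.time_bind, h]
  simp

end IsSearch

theorem ev_verify {N : ℕ} (f : Fin N → Timed Bool) (i : Fin N) (φ : Option (Fin N) → ℝ) :
    (verify f i).ev φ = if (f i).val then φ (some i) else φ none := by
  simp only [verify, QProg.bind_eq, QProg.ev_tick_bind, QProg.pure_eq, QProg.ev_ret]
  split_ifs <;> rfl

theorem time_verify_le {N : ℕ} (f : Fin N → Timed Bool) (i : Fin N) :
    (verify f i).time ≤ evalTime f := by
  simpa [verify] using cost_le_evalTime f i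

theorem sum_mul_verify {N : ℕ} (f : Fin N → Timed Bool) (w : Fin N → ℝ) (r : ℝ)
    (hw : ∀ i ∈ solutions f, w i = r) (φ : Option (Fin N) → ℝ) :
    ∑ i, w i * (verify f i).ev φ =
      (∑ i with ¬ (f i).val, w i) * φ none + r * ∑ i ∈ solutions f, φ (some i) := by
  rw [← Finset.sum_filter_add_sum_filter_not Finset.univ (fun i => (f i).val = true), add_comm,
    Finset.sum_mul, Finset.mul_sum]
  congr 1
  · refine Finset.sum_congr rfl fun i hi => ?_
    rw [ev_verify, if_neg (Finset.mem_filter.mp hi).2]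
  · refine Finset.sum_congr rfl fun i hi => ?_
    rw [ev_verify, if_pos (Finset.mem_filter.mp hi).2, hw i hi]

/-! ### Success probability and cost of one Grover trial. -/

/-- The sum telescopes, as 2 sin 2θ cos 2φ = sin(2φ + 2θ) - sin(2φ - 2θ) with φ = (2j+1)θ. -/
theorem sum_sin_sq_odd (θ : ℝ) (m : ℕ) :
    4 * Real.sin (2 * θ) * ∑ j ∈ Finset.range m, Real.sin ((2 * j + 1) * θ) ^ 2 =
      2 * m * Real.sin (2 * θ) - Real.sin (4 * m * θ) := by
  induction m with
  | zero => simp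
  | succ m ih =>
    rw [Finset.sum_range_succ, mul_add, ih]
    have h1 : (4 * ((m + 1 : ℕ) : ℝ) * θ) = (2 * ((2 * m + 1) * θ)) + 2 * θ := by push_cast; ring
    have h2 : 4 * (m : ℝ) * θ = (2 * ((2 * m + 1) * θ)) - 2 * θ := by ring
    rw [h1, h2, Real.sin_add, Real.sin_sub]
    push_cast
    linear_combination (2 * Real.sin (2 * θ)) *
      (Real.cos_two_mul ((2 * m + 1) * θ) + 2 * Real.cos_sq' ((2 * m + 1) * θ))

/-- By the closed form, it suffices that sin 4mθ ≤ m sin 2θ. For θ ≤ π/3 the right side is at least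
1; larger angles, where solutions abound, need a separate argument. -/
theorem quarter_le_sum_sin_sq_odd {θ : ℝ} (h0 : 0 < θ) (h1 : θ ≤ Real.pi / 2) {m : ℕ}
    (hm : 1 ≤ m * Real.sin θ) :
    (m : ℝ) / 4 ≤ ∑ j ∈ Finset.range m, Real.sin ((2 * j + 1) * θ) ^ 2 := by
  have hpi := Real.pi_pos
  have key := sum_sin_sq_odd θ m
  have hsin : 0 < Real.sin θ := Real.sin_pos_of_pos_of_lt_pi h0 (by linarith)
  have hm1 : (1 : ℝ) ≤ m := by
    rcases Nat.eq_zero_or_pos m with rfl | h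
    · simp at hm; linarith
    · exact_mod_cast h
  rcases h1.eq_or_lt with rfl | h1
  · have : ∀ j : ℕ, Real.sin ((2 * j + 1) * (Real.pi / 2)) ^ 2 = 1 := by
      intro j
      have : (2 * (j : ℝ) + 1) * (Real.pi / 2) = j * Real.pi + Real.pi / 2 := by ring
      rw [this, Real.sin_add_pi_div_two, Real.cos_nat_mul_pi, ← pow_mul, mul_comm, pow_mul]
      simp
    simp only [this, Finset.sum_const, Finset.card_range, nsmul_eq_mul]
    linarith
  have hsin2 : 0 < Real.sin (2 * θ) := Real.sin_pos_of_pos_of_lt_pi (by linarith) (by linarith)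
  suffices h : Real.sin (4 * m * θ) ≤ m * Real.sin (2 * θ) by
    have : 4 * Real.sin (2 * θ) * (m / 4) ≤ 4 * Real.sin (2 * θ) *
        ∑ j ∈ Finset.range m, Real.sin ((2 * j + 1) * θ) ^ 2 := by
      rw [key]; linarith
    exact le_of_mul_le_mul_left this (by linarith)
  rcases le_total θ (Real.pi / 3) with h3 | h3
  · have hc : 1 / 2 ≤ Real.cos θ := by
      rw [← Real.cos_pi_div_three]
      exact Real.cos_le_cos_of_nonneg_of_le_pi h0.le (by linarith) h3
    have : 1 ≤ m * Real.sin (2 * θ) := by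
      rw [Real.sin_two_mul]
      nlinarith
    exact (Real.sin_le_one _).trans this
  -- Reflecting at π/2 turns the claim into -sin 4mδ ≤ m sin 2δ: the left side is nonpositive while
  -- 4mδ ≤ π, and afterwards Jordan's inequality makes the right side at least 1.
  · obtain ⟨δ, rfl⟩ : ∃ δ, θ = Real.pi / 2 - δ := ⟨Real.pi / 2 - θ, by ring⟩
    have e1 : Real.sin (4 * m * (Real.pi / 2 - δ)) = -Real.sin (4 * m * δ) := by
      have : 4 * (m : ℝ) * (Real.pi / 2 - δ) = m * (2 * Real.pi) - 4 * m * δ := by ring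
      rw [this, Real.sin_nat_mul_two_pi_sub]
    have e2 : Real.sin (2 * (Real.pi / 2 - δ)) = Real.sin (2 * δ) := by
      rw [show 2 * (Real.pi / 2 - δ) = Real.pi - 2 * δ by ring, Real.sin_pi_sub]
    rw [e1, e2]
    have hδ : 0 < δ := by linarith
    have jordan := Real.mul_le_sin (x := 2 * δ) (by linarith) (by linarith)
    rcases le_total (4 * m * δ) Real.pi with h4 | h4
    · have := Real.sin_nonneg_of_nonneg_of_le_pi (x := 4 * m * δ) (by positivity) h4
      have h5 : 0 ≤ m * Real.sin (2 * δ) :=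
        mul_nonneg (by linarith) ((by positivity : (0 : ℝ) ≤ 2 / Real.pi * (2 * δ)).trans jordan)
      linarith
    · have h5 : 1 ≤ m * (2 / Real.pi * (2 * δ)) := by
        rw [show m * (2 / Real.pi * (2 * δ)) = (4 * m * δ) / Real.pi by ring, le_div_iff₀ hpi]
        linarith
      have h6 : m * (2 / Real.pi * (2 * δ)) ≤ m * Real.sin (2 * δ) := by gcongr
      have := Real.neg_one_le_sin (4 * m * δ)
      linarith

section Angle

variable {N t : ℕ}

theorem sin_groverAngle (h : t ≤ N) : Real.sin (groverAngle N t) = √((t : ℝ) / N) := by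
  have h0 : (0 : ℝ) ≤ √((t : ℝ) / N) := Real.sqrt_nonneg _
  refine Real.sin_arcsin (by linarith) (Real.sqrt_le_one.mpr ?_)
  exact div_le_one_of_le₀ (by exact_mod_cast h) (Nat.cast_nonneg _)

theorem sin_groverAngle_sq (h : t ≤ N) : Real.sin (groverAngle N t) ^ 2 = (t : ℝ) / N := by
  rw [sin_groverAngle h, Real.sq_sqrt (by positivity)]

theorem groverAngle_pos (h0 : 0 < t) (h : t ≤ N) : 0 < groverAngle N t := by
  have : 0 < N := h0.trans_le h
  exact Real.arcsin_pos.mpr (by positivity)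

theorem groverAngle_le : groverAngle N t ≤ Real.pi / 2 := Real.arcsin_le_pi_div_two _

end Angle

section Grover

variable {N : ℕ}

theorem card_solutions_le (f : Fin N → Timed Bool) : (solutions f).card ≤ N := by
  simpa using Finset.card_le_univ (solutions f)

theorem norm_sq_uniformState (i : Fin N) : ‖uniformState N i‖ ^ 2 = 1 / N := by
  simp [uniformState, abs_of_nonneg (Real.sqrt_nonneg _)]

theorem norm_sq_final_grover [NeZero N] (f : Fin N → Timed Bool) (j : ℕ) {i : Fin N}
    (hi : i ∈ solutions f) :
    ‖((groverGates (uniformState N) f j).foldl (fun φ g => g.unitary φ) (uniformState N)) i‖ ^ 2 *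
      (solutions f).card = Real.sin ((2 * j + 1) * groverAngle N (solutions f).card) ^ 2 := by
  have hp : ∑ i with (f i).val, ‖uniformState N i‖ ^ 2 =
      Real.sin (groverAngle N (solutions f).card) ^ 2 := by
    rw [sin_groverAngle_sq (card_solutions_le f)]
    simp only [norm_sq_uniformState, Finset.sum_const, nsmul_eq_mul, solutions]
    ring
  rw [final_grover _ (norm_uniformState N) f _ hp, if_pos (Finset.mem_filter.mp hi).2, norm_mul,
    mul_pow, norm_sq_uniformState, ← (groverFactor_sin_cos _ j).1, mul_pow,
    sin_groverAngle_sq (card_solutions_le f), Complex.norm_real, Real.norm_eq_abs, sq_abs]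
  ring

end Grover

theorem sqrt_div_mul_sqrt_div {x y : ℝ} (hx : 0 < x) (hy : 0 < y) : √(y / x) * √(x / y) = 1 := by
  rw [← Real.sqrt_mul (by positivity), div_mul_div_cancel₀ hx.ne', div_self hy.ne', Real.sqrt_one]

section Trial

variable {N : ℕ} [NeZero N]

theorem ev_groverTrial (f : Fin N → Timed Bool) (m : ℝ) (hm : 0 < m)
    (φ : Option (Fin N) → ℝ) :
    (groverTrial f m hm).ev φ = (∑ j : Fin ⌈m⌉₊, ∑ i, ‖((groverGates (uniformState N) f j).foldl
      (fun φ g => g.unitary φ) (uniformState N)) i‖ ^ 2 * (verify f i).ev φ) / ⌈m⌉₊ := by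
  rfl

theorem time_groverTrial (f : Fin N → Timed Bool) (m : ℝ) (hm : 0 < m) :
    (groverTrial f m hm).time ≤ (2 * evalTime f + 4) * (1 + m) := by
  have hj : ∀ j : Fin ⌈m⌉₊, ((grover f j).bind (verify f)).time ≤
      m * (2 * evalTime f + 2) + 2 + evalTime f := by
    intro j
    refine QProg.time_bind_le ?_ fun i => time_verify_le f i
    have hjm : ((j : ℕ) : ℝ) ≤ m := (Nat.lt_ceil.mp j.2).le
    simp only [grover, QProg.time, mul_zero, Finset.sum_const_zero, add_zero, Circuit.cost,
      sum_cost_groverGates]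
    push_cast
    gcongr
  have h : (groverTrial f m hm).time ≤
      (1 : ℕ) + (1 + (m * (2 * evalTime f + 2) + 2 + evalTime f)) := by
    change ((QProg.tick 1).bind fun _ => (QProg.toss ⌈m⌉₊ (Nat.ceil_pos.mpr hm) QProg.ret).bind
      fun j => (grover f j).bind (verify f)).time ≤ _
    rw [QProg.time_tick_bind]
    gcongr
    exact QProg.time_bind_le (by simp [QProg.time]) hj
  have : (0 : ℝ) ≤ evalTime f := Nat.cast_nonneg _
  refine h.trans ?_
  push_cast
  nlinarith

theorem exists_isSearch_groverTrial (f : Fin N → Timed Bool) (m : ℝ) (hm : 0 < m) :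
    ∃ δ, IsSearch (groverTrial f m hm) (solutions f) δ ∧
      (0 < (solutions f).card → √(N / (solutions f).card) ≤ m → δ ≤ 3 / 4) := by
  set t := (solutions f).card with ht
  set M := ⌈m⌉₊
  have hM : 0 < M := Nat.ceil_pos.mpr hm
  set θ := groverAngle N t
  set A : ℕ → ℝ := fun j => Real.sin ((2 * j + 1) * θ) ^ 2
  set w : ℕ → Fin N → ℝ := fun j i => ‖((groverGates (uniformState N) f j).foldl
      (fun φ g => g.unitary φ) (uniformState N)) i‖ ^ 2
  have hw : ∀ j, ∀ i ∈ solutions f, w j i = A j / t := by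
    intro j i hi
    have : (0 : ℝ) < t := Nat.cast_pos.mpr (Finset.card_pos.mpr ⟨i, hi⟩)
    rw [eq_div_iff this.ne']
    exact norm_sq_final_grover f j hi
  have hev : ∀ φ : Option (Fin N) → ℝ, (groverTrial f m hm).ev φ =
      ((∑ j ∈ Finset.range M, ∑ i with ¬ (f i).val, w j i) / M) * φ none +
        ((∑ j ∈ Finset.range M, A j) / (M * t)) * ∑ i ∈ solutions f, φ (some i) := by
    intro φ
    rw [ev_groverTrial, Fin.sum_univ_eq_sum_range (fun j => ∑ i, w j i * (verify f i).ev φ)]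
    simp_rw [fun j => sum_mul_verify f (w j) _ (hw j) φ]
    rw [Finset.sum_add_distrib, ← Finset.sum_mul, ← Finset.sum_mul, ← Finset.sum_div]
    ring
  have hA : 0 ≤ ∑ j ∈ Finset.range M, A j := Finset.sum_nonneg fun j _ => sq_nonneg _
  refine ⟨_, IsSearch.of_forall ?_ (div_nonneg hA (by positivity)) hev, fun h0 hs => ?_⟩
  · refine div_nonneg (Finset.sum_nonneg fun j _ => Finset.sum_nonneg fun i _ => sq_nonneg _)
      (Nat.cast_nonneg _)
  · have h1 := hev fun _ => 1
    rw [QProg.ev_const, mul_one, Finset.sum_const, nsmul_eq_mul, mul_one, ← ht] at h1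
    have ht0 : (0 : ℝ) < t := Nat.cast_pos.mpr h0
    have hM0 : (0 : ℝ) < M := Nat.cast_pos.mpr hM
    have htN := card_solutions_le f
    have hN0 : (0 : ℝ) < N := ht0.trans_le (Nat.cast_le.mpr htN)
    have h2 : (M : ℝ) / 4 ≤ ∑ j ∈ Finset.range M, A j := by
      refine quarter_le_sum_sin_sq_odd (groverAngle_pos h0 htN) groverAngle_le ?_
      rw [sin_groverAngle htN]
      rw [← sqrt_div_mul_sqrt_div ht0 hN0]
      exact mul_le_mul_of_nonneg_right (hs.trans (Nat.le_ceil m)) (Real.sqrt_nonneg _)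
    have h3 : (∑ j ∈ Finset.range M, A j) / (M * t) * t = (∑ j ∈ Finset.range M, A j) / M := by
      rw [div_mul_eq_mul_div, mul_div_mul_right _ _ ht0.ne']
    have h4 : 1 / 4 ≤ (∑ j ∈ Finset.range M, A j) / M := by
      rw [le_div_iff₀ hM0]; linarith
    linarith

end Trial

/-! ### Exact search with an ancilla qubit. -/

section ExactSearch

variable {N : ℕ}

theorem norm_sq_tiltedState (β : ℝ) (x : Fin N × Bool) :
    ‖tiltedState N β x‖ ^ 2 = 1 / N * (if x.2 then Real.sin β ^ 2 else Real.cos β ^ 2) := by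
  rw [tiltedState]
  simp only [Complex.norm_real, Real.norm_eq_abs, sq_abs, mul_pow, div_pow, one_pow,
    Real.sq_sqrt (Nat.cast_nonneg N)]
  split_ifs <;> rfl

/-- Rounding the iteration count up makes the target angle no larger than the Grover angle, so the
ancilla only has to lower it and its arcsine is genuine. -/
theorem exactIter_mul_le {t : ℕ} (h0 : 0 < t) (h : t ≤ N) :
    Real.pi / (2 * (2 * exactIter N t + 1)) ≤ groverAngle N t := by
  have hθ := groverAngle_pos h0 h
  have h1 : Real.pi / (4 * groverAngle N t) - 1 / 2 ≤ exactIter N t := Nat.le_ceil _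
  rw [sub_le_iff_le_add, div_le_iff₀ (by positivity)] at h1
  rw [div_le_iff₀ (by positivity)]
  linarith

theorem sin_exactAncilla {t : ℕ} (h0 : 0 < t) (h : t ≤ N) :
    Real.sin (groverAngle N t) * Real.sin (exactAncilla N t) =
      Real.sin (Real.pi / (2 * (2 * exactIter N t + 1))) := by
  have hpi := Real.pi_pos
  have hθ := groverAngle_pos h0 h
  have hle := groverAngle_le (N := N) (t := t)
  have hα : 0 < Real.pi / (2 * (2 * exactIter N t + 1)) := by positivity
  have hαθ := exactIter_mul_le h0 h
  have hsin : 0 < Real.sin (groverAngle N t) := Real.sin_pos_of_pos_of_lt_pi hθ (by linarith)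
  have hsin' := Real.sin_nonneg_of_nonneg_of_le_pi hα.le (by linarith)
  rw [exactAncilla, Real.sin_arcsin, mul_div_cancel₀ _ hsin.ne']
  · exact (by norm_num : (-1 : ℝ) ≤ 0).trans (div_nonneg hsin' hsin.le)
  · rw [div_le_one hsin]
    exact Real.sin_le_sin_of_le_of_le_pi_div_two (by linarith) hle hαθ

theorem time_exactSearch [NeZero N] (f : Fin N → Timed Bool) {t : ℕ} (h0 : 0 < t) (h : t ≤ N) :
    (exactSearch f t).time ≤ 3 * (2 * evalTime f + 4) * √(N / t) := by
  have hN0 : (0 : ℝ) < N := Nat.cast_pos.mpr (h0.trans_le h)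
  have ht0 : (0 : ℝ) < t := Nat.cast_pos.mpr h0
  have hθ := groverAngle_pos h0 h
  have hs1 : 1 ≤ √((N : ℝ) / t) := by
    rw [Real.one_le_sqrt, one_le_div ht0]
    exact_mod_cast h
  have hiter : (exactIter N t : ℝ) ≤ 3 / 2 * √(N / t) := by
    have h1 : √((t : ℝ) / N) ≤ groverAngle N t := by
      rw [← sin_groverAngle h]
      exact Real.sin_le hθ.le
    have h2 : Real.pi / (4 * groverAngle N t) ≤ √(N / t) := by
      rw [div_le_iff₀ (by positivity)]
      have := sqrt_div_mul_sqrt_div ht0 hN0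
      have h3 : √((N : ℝ) / t) * √(t / N) ≤ √(N / t) * groverAngle N t := by gcongr
      have := Real.pi_le_four
      linarith
    rcases Nat.eq_zero_or_pos (exactIter N t) with h3 | h3
    · rw [h3]; push_cast; positivity
    · have h4 : (0 : ℝ) < Real.pi / (4 * groverAngle N t) - 1 / 2 := Nat.ceil_pos.mp h3
      have h5 := Nat.ceil_lt_add_one h4.le
      rw [exactIter]
      linarith
  set g : Fin N × Bool → Timed Bool := fun x => ⟨(f x.1).val && x.2, (f x.1).cost + 1⟩ with hg
  have hE : evalTime g ≤ evalTime f + 1 :=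
    Finset.sup_le fun x _ => Nat.succ_le_succ (cost_le_evalTime f x.1)
  have hE' : (evalTime g : ℝ) ≤ evalTime f + 1 := by exact_mod_cast hE
  have key : (exactSearch f t).time ≤
      (1 : ℕ) + ((exactIter N t * (2 * evalTime g + 2) + 2) + evalTime f) := by
    change ((QProg.tick 1).bind fun _ => (QProg.measure (Fin N × Bool) _ QProg.ret).bind
      fun x => verify f x.1).time ≤ _
    rw [QProg.time_tick_bind]
    gcongr
    refine QProg.time_bind_le ?_ fun x => time_verify_le f x.1
    simp only [QProg.time, mul_zero, Finset.sum_const_zero, add_zero, Circuit.cost,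
      sum_cost_groverGates]
    push_cast
    exact le_rfl
  have hE0 : (0 : ℝ) ≤ evalTime f := Nat.cast_nonneg _
  have h6 : (exactIter N t : ℝ) * (2 * evalTime g + 2) ≤
      3 / 2 * √(N / t) * (2 * evalTime f + 4) :=
    mul_le_mul hiter (by linarith) (by positivity) (by positivity)
  push_cast at key
  nlinarith

/-- With the right `t`, the lowered angle is π/(2(2J+1)), and `J` iterations rotate it to π/2. With
a wrong `t` the search is still symmetric, because all solutions have equal weight. -/
theorem exists_isSearch_exactSearch [NeZero N] (f : Fin N → Timed Bool) (t : ℕ) :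
    ∃ δ, IsSearch (exactSearch f t) (solutions f) δ ∧
      (0 < t → (solutions f).card = t → δ = 0) := by
  set β := exactAncilla N t with hβ
  set g : Fin N × Bool → Timed Bool := fun x => ⟨(f x.1).val && x.2, (f x.1).cost + 1⟩ with hg
  set J := exactIter N t with hJ
  set F := (groverGates (tiltedState N β) g J).foldl (fun φ g => g.unitary φ) (tiltedState N β)
    with hF
  obtain ⟨p, hp⟩ : ∃ p, p = (solutions f).card / N * Real.sin β ^ 2 := ⟨_, rfl⟩
  have hsum : ∑ x with (g x).val, ‖tiltedState N β x‖ ^ 2 = p := by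
    simp only [norm_sq_tiltedState, Finset.sum_filter, Fintype.sum_prod_type, hg, hp,
      Fintype.sum_bool]
    simp [← Finset.sum_filter, solutions]
    ring
  have hfin := final_grover _ (norm_tiltedState N β) g p hsum J
  set w : Fin N → ℝ := fun i => ‖F (i, true)‖ ^ 2 + ‖F (i, false)‖ ^ 2 with hw
  have hw0 : ∀ i, 0 ≤ w i := fun i => by positivity
  -- A solution is measured with either ancilla value; the pair with ancilla 0 is a bad basis state,
  -- hence the second summand.
  set r := 1 / N * ((groverFactor p J).1 ^ 2 * Real.sin β ^ 2 +
    (groverFactor p J).2 ^ 2 * Real.cos β ^ 2) with hr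
  have hwr : ∀ i ∈ solutions f, w i = r := by
    intro i hi
    have hi' := (Finset.mem_filter.mp hi).2
    change ‖F (i, true)‖ ^ 2 + ‖F (i, false)‖ ^ 2 = r
    rw [hfin (i, true), hfin (i, false)]
    simp only [norm_mul, mul_pow, norm_sq_tiltedState, Complex.norm_real, Real.norm_eq_abs, sq_abs]
    simp [hg, hr, hi']
    ring
  have hev : ∀ φ : Option (Fin N) → ℝ, (exactSearch f t).ev φ =
      (∑ i with ¬ (f i).val, w i) * φ none + r * ∑ i ∈ solutions f, φ (some i) := by
    intro φ
    rw [← sum_mul_verify f w r hwr φ]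
    change ∑ x : Fin N × Bool, ‖F x‖ ^ 2 * (verify f x.1).ev φ = _
    rw [Fintype.sum_prod_type]
    simp [hw, add_mul]
  have hr0 : 0 ≤ r := by positivity
  refine ⟨_, IsSearch.of_forall (Finset.sum_nonneg fun i _ => hw0 i) hr0 hev, fun h0 hs => ?_⟩
  have htN : t ≤ N := hs ▸ card_solutions_le f
  have h1 := hev fun _ => 1
  rw [QProg.ev_const, mul_one, Finset.sum_const, nsmul_eq_mul, mul_one, hs] at h1
  have hδ : 0 ≤ ∑ i with ¬ (f i).val, w i := Finset.sum_nonneg fun i _ => hw0 i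
  have hp' : p = Real.sin (Real.pi / (2 * (2 * J + 1))) ^ 2 := by
    rw [hp, hs, ← sin_groverAngle_sq htN, ← mul_pow, sin_exactAncilla h0 htN]
  have ha : (groverFactor p J).1 ^ 2 * p = 1 := by
    have h := (groverFactor_sin_cos (Real.pi / (2 * (2 * J + 1))) J).1
    have h2 : (2 * (J : ℝ) + 1) * (Real.pi / (2 * (2 * J + 1))) = Real.pi / 2 := by
      have : 2 * (J : ℝ) + 1 ≠ 0 := by positivity
      field_simp
    rw [h2, Real.sin_pi_div_two, ← hp'] at h
    nth_rewrite 2 [hp']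
    rw [← mul_pow, h, one_pow]
  have h3 : 1 ≤ r * t := by
    have hN0 : (0 : ℝ) < N := Nat.cast_pos.mpr (h0.trans_le htN)
    rw [hp, hs] at ha
    have h4 : r * t = (groverFactor p J).1 ^ 2 * (t / N * Real.sin β ^ 2) +
        t / N * ((groverFactor p J).2 ^ 2 * Real.cos β ^ 2) := by
      rw [hr]
      ring
    rw [h4, hp, hs, ha]
    have : 0 ≤ (t : ℝ) / N * ((groverFactor (t / N * Real.sin β ^ 2) J).2 ^ 2 * Real.cos β ^ 2) := by
      positivity
    linarith
  linarith

end ExactSearch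

theorem IsSearch.time_orElseRun_le {N : ℕ} {p : QProg (Option (Fin N))} {S : Finset (Fin N)} {δ x y : ℝ}
    (hp : IsSearch p S δ) (hx : p.time ≤ x) {q : QProg (Option (Fin N))} (hy : q.time ≤ y) :
    (p.orElseRun q).time ≤ x + y := by
  rw [hp.time_orElseRun]
  have := mul_le_of_le_one_left q.time_nonneg hp.le_one
  linarith

theorem sqrt_bcwzThreshold_le {N : ℕ} {εinv : ℝ} (h : 2 ≤ εinv) :
    √(bcwzThreshold N εinv) ≤ 3 / 2 * √(Real.logb 2 εinv) := by
  have hL : 1 ≤ Real.logb 2 εinv := by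
    rw [Real.le_logb_iff_rpow_le one_lt_two (by linarith)]
    simpa using h
  have h1 : (bcwzThreshold N εinv : ℝ) ≤ ⌈Real.logb 2 εinv⌉₊ := by
    exact_mod_cast min_le_left _ _
  have h2 := Nat.ceil_lt_add_one (zero_le_one.trans hL)
  rw [Real.sqrt_le_left (by positivity), mul_pow, Real.sq_sqrt (by linarith)]
  linarith

/-! ### BBHT, BCWZ and findsol. -/

section Loops

variable {N : ℕ} [NeZero N]

theorem time_groverTrial_of_one_le (f : Fin N → Timed Bool) {m : ℝ} (hm : 0 < m) (h1 : 1 ≤ m) :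
    (groverTrial f m hm).time ≤ 2 * (2 * evalTime f + 4) * m := by
  have h0 : (0 : ℝ) ≤ 2 * evalTime f + 4 := by positivity
  have := time_groverTrial f m hm
  nlinarith

/-- A geometric sum, with 14 = 2 / (8/7 - 1). -/
theorem time_bbhtLoop (f : Fin N → Timed Bool) (n k : ℕ) :
    (bbhtLoop f n k).time ≤
      14 * (2 * evalTime f + 4) * ((8 / 7 : ℝ) ^ (n + k) - (8 / 7 : ℝ) ^ k) := by
  induction n generalizing k with
  | zero => simp [bbhtLoop]
  | succ n ih =>
    obtain ⟨δ, hδ, -⟩ := exists_isSearch_groverTrial f ((8 / 7 : ℝ) ^ k) (by positivity)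
    have h1 : (1 : ℝ) ≤ (8 / 7) ^ k := one_le_pow₀ (by norm_num)
    refine (hδ.time_orElseRun_le (time_groverTrial_of_one_le f _ h1) (ih (k + 1))).trans
      (le_of_eq ?_)
    rw [show n + 1 + k = n + (k + 1) by ring, pow_succ _ k]
    ring

/-- Two regimes, after and before the range reaches the critical value `s`. Afterwards each round
fails with probability at most 3/4: the time closes by 2 + 3/4 · 14 · 8/7 = 14, and the failure by
3/4 · (8/7)² = 48/49 ≤ 1. Earlier rounds are only charged for their time. -/
theorem exists_isSearch_bbhtLoop (f : Fin N → Timed Bool) {s : ℝ}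
    (ht : 0 < (solutions f).card) (hs : s = √(N / (solutions f).card)) (n k : ℕ) :
    ∃ δ, IsSearch (bbhtLoop f n k) (solutions f) δ ∧
      (s ≤ (8 / 7) ^ k → δ * ((8 / 7 : ℝ) ^ n) ^ 2 ≤ 1 ∧
        (bbhtLoop f n k).time ≤ 14 * (2 * evalTime f + 4) * (8 / 7 : ℝ) ^ k) ∧
      ((8 / 7) ^ k < s → δ * ((8 / 7 : ℝ) ^ (n + k)) ^ 2 ≤ (8 / 7 * s) ^ 2 ∧
        (bbhtLoop f n k).time ≤
          32 * (2 * evalTime f + 4) * s - 14 * (2 * evalTime f + 4) * (8 / 7 : ℝ) ^ k) := by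
  obtain ⟨κ, hκ⟩ : ∃ κ : ℝ, κ = 2 * evalTime f + 4 := ⟨_, rfl⟩
  have hκ0 : 0 ≤ κ := by rw [hκ]; positivity
  rw [← hκ]
  induction n generalizing k with
  | zero =>
    have h1 : (0 : ℝ) < (8 / 7) ^ k := by positivity
    refine ⟨1, IsSearch.ret_none, fun h => ⟨by norm_num, ?_⟩, fun h => ⟨?_, ?_⟩⟩
    · simp only [bbhtLoop, QProg.pure_eq, QProg.time_ret]
      positivity
    · rw [one_mul, zero_add]
      gcongr
      linarith
    · simp only [bbhtLoop, QProg.pure_eq, QProg.time_ret]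
      nlinarith
  | succ n ih =>
    obtain ⟨δ, hδ, hδ'⟩ := exists_isSearch_groverTrial f ((8 / 7 : ℝ) ^ k) (by positivity)
    obtain ⟨η, hη, h1, h2⟩ := ih (k + 1)
    have hb : (1 : ℝ) ≤ (8 / 7) ^ k := one_le_pow₀ (by norm_num)
    have hbn : (0 : ℝ) < (8 / 7) ^ n := by positivity
    have hT := time_groverTrial_of_one_le f (m := (8 / 7 : ℝ) ^ k) (by positivity) hb
    rw [← hκ] at hT
    have hη0 := hη.nonneg
    have hδ0 := hδ.nonneg
    have hq0 := (bbhtLoop f n (k + 1)).time_nonneg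
    have hδq := mul_le_of_le_one_left hq0 hδ.le_one
    have hδη := mul_le_of_le_one_left hη0 hδ.le_one
    rw [pow_succ] at h1 h2
    refine ⟨_, hδ.orElseRun hη, fun h => ?_, fun h => ?_⟩
    · obtain ⟨h3, h4⟩ := h1 (by linarith)
      have h5 := hδ' ht (hs ▸ h)
      rw [bbhtLoop, hδ.time_orElseRun]
      constructor
      · rw [pow_succ (8 / 7 : ℝ) n]
        have h6 : δ * (η * ((8 / 7) ^ n) ^ 2) ≤ 3 / 4 * 1 :=
          mul_le_mul h5 h3 (by positivity) (by norm_num)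
        nlinarith
      · have h6 : δ * (bbhtLoop f n (k + 1)).time ≤ 3 / 4 * (14 * κ * ((8 / 7) ^ k * (8 / 7))) :=
          mul_le_mul h5 h4 hq0 (by norm_num)
        linarith
    · rw [bbhtLoop, hδ.time_orElseRun]
      have e : (8 / 7 : ℝ) ^ (n + 1 + k) = (8 / 7) ^ n * (8 / 7) * (8 / 7) ^ k := by
        rw [pow_add, pow_succ]
      rw [e]
      -- If the next range b · 8/7 is the first critical one, the cost is 2b + 14 · 8/7 · b = 18b ≤
      -- 32s - 14b in units of `κ`, as b < s.
      rcases le_or_gt s ((8 / 7) ^ k * (8 / 7)) with h' | h'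
      · obtain ⟨h3, h4⟩ := h1 h'
        constructor
        · calc δ * η * ((8 / 7) ^ n * (8 / 7) * (8 / 7) ^ k) ^ 2
              ≤ η * ((8 / 7) ^ n * (8 / 7) * (8 / 7) ^ k) ^ 2 := by gcongr
            _ = (η * ((8 / 7) ^ n) ^ 2) * (8 / 7 * (8 / 7) ^ k) ^ 2 := by ring
            _ ≤ 1 * (8 / 7 * s) ^ 2 := by gcongr
            _ = _ := one_mul _
        · nlinarith
      · obtain ⟨h3, h4⟩ := h2 h'
        constructor
        · calc δ * η * ((8 / 7) ^ n * (8 / 7) * (8 / 7) ^ k) ^ 2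
              ≤ η * ((8 / 7) ^ n * (8 / 7) * (8 / 7) ^ k) ^ 2 := by gcongr
            _ = η * ((8 / 7) ^ (n + (k + 1))) ^ 2 := by ring
            _ ≤ _ := h3
        · linarith

theorem time_bbht (f : Fin N → Timed Bool) :
    (bbht f).time ≤ 32 * (2 * evalTime f + 4) * √N := by
  have hN := NeZero.pos N
  have h := time_bbhtLoop f (bbhtRounds N) 0
  obtain ⟨r, hr⟩ : ∃ r, bbhtRounds N = r + 1 := ⟨_, rfl⟩
  have h1 := (lt_bbhtRounds_iff hN r).mp (by omega)
  refine h.trans ?_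
  rw [hr, add_zero, pow_zero, pow_succ]
  have : (0 : ℝ) ≤ 2 * evalTime f + 4 := by positivity
  nlinarith

theorem exists_isSearch_bbht (f : Fin N → Timed Bool) :
    ∃ δ, IsSearch (bbht f) (solutions f) δ ∧ (0 < (solutions f).card →
      δ * (solutions f).card ≤ 16 / 49 ∧
      (bbht f).time ≤ 32 * (2 * evalTime f + 4) * √(N / (solutions f).card)) := by
  rcases Nat.eq_zero_or_pos (solutions f).card with h0 | h0
  · suffices h : ∀ n k, ∃ δ, IsSearch (bbhtLoop f n k) (solutions f) δ by
      obtain ⟨δ, hδ⟩ := h (bbhtRounds N) 0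
      exact ⟨δ, hδ, fun h => by omega⟩
    intro n
    induction n with
    | zero => exact fun k => ⟨1, IsSearch.ret_none⟩
    | succ n ih =>
      intro k
      obtain ⟨δ, hδ, -⟩ := exists_isSearch_groverTrial f ((8 / 7 : ℝ) ^ k) (by positivity)
      obtain ⟨η, hη⟩ := ih (k + 1)
      exact ⟨_, hδ.orElseRun hη⟩
  · obtain ⟨δ, hδ, h1, h2⟩ := exists_isSearch_bbhtLoop f h0 rfl (bbhtRounds N) 0
    refine ⟨δ, hδ, fun _ => ?_⟩
    set t := (solutions f).card with ht
    have ht0 : (0 : ℝ) < t := Nat.cast_pos.mpr h0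
    have htN : (t : ℝ) ≤ N := Nat.cast_le.mpr (card_solutions_le f)
    have hN0 : (0 : ℝ) < N := ht0.trans_le htN
    have hs1 : 1 ≤ √((N : ℝ) / t) := by rwa [Real.one_le_sqrt, one_le_div ht0]
    have hκ : (0 : ℝ) ≤ 2 * evalTime f + 4 := by positivity
    have hR : 2 * √(N : ℝ) < (8 / 7) ^ bbhtRounds N :=
      not_le.mp fun h => lt_irrefl _ ((lt_bbhtRounds_iff (NeZero.pos N) _).mpr h)
    have key : δ * ((8 / 7 : ℝ) ^ bbhtRounds N) ^ 2 ≤ (8 / 7 * √(N / t)) ^ 2 ∧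
        (bbht f).time ≤ 32 * (2 * evalTime f + 4) * √(N / t) := by
      rcases le_or_gt √((N : ℝ) / t) 1 with h | h
      · obtain ⟨h3, h4⟩ := h1 (by simpa using h)
        refine ⟨h3.trans (by nlinarith), h4.trans ?_⟩
        rw [pow_zero]
        nlinarith
      · obtain ⟨h3, h4⟩ := h2 (by simpa using h)
        refine ⟨h3, h4.trans ?_⟩
        rw [pow_zero]
        linarith
    refine ⟨?_, key.2⟩
    -- The final range exceeds 2√N, so 4Nδ ≤ (8/7)² N/t, which gives 16/49.
    have h3 : (2 * √(N : ℝ)) ^ 2 ≤ ((8 / 7 : ℝ) ^ bbhtRounds N) ^ 2 := by gcongr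
    have h4 := (mul_le_mul_of_nonneg_left h3 hδ.nonneg).trans key.1
    rw [mul_pow, mul_pow, Real.sq_sqrt hN0.le, Real.sq_sqrt (by positivity), mul_div_assoc',
      le_div_iff₀ ht0] at h4
    have h5 : N * (δ * t) ≤ N * (16 / 49) := by linarith
    exact le_of_mul_le_mul_left h5 hN0

theorem one_div_sqrt_succ_le (m : ℕ) :
    1 / √((m : ℝ) + 1) ≤ 2 * (√((m : ℝ) + 1) - √m) := by
  have h1 : (0 : ℝ) < √((m : ℝ) + 1) := by positivity
  have h2 : √(m : ℝ) ≤ √((m : ℝ) + 1) := Real.sqrt_le_sqrt (by linarith)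
  have h3 := Real.sq_sqrt (show (0 : ℝ) ≤ m by positivity)
  have h4 := Real.sq_sqrt (show (0 : ℝ) ≤ (m : ℝ) + 1 by positivity)
  rw [div_le_iff₀ h1]
  nlinarith [sq_nonneg (√((m : ℝ) + 1) - √m)]

/-- The costs √(N/t) are summed by telescoping √t. -/
theorem time_exactLoop (f : Fin N → Timed Bool) (r m : ℕ) (h : m + r ≤ N) :
    (exactLoop f r (m + 1)).time ≤
      6 * (2 * evalTime f + 4) * √N * (√((m + r : ℕ) : ℝ) - √m) := by
  induction r generalizing m with
  | zero => simp [exactLoop]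
  | succ r ih =>
    obtain ⟨δ, hδ, -⟩ := exists_isSearch_exactSearch f (m + 1)
    refine (hδ.time_orElseRun_le (time_exactSearch f m.succ_pos (by omega))
      (ih (m + 1) (by omega))).trans ?_
    rw [show m + 1 + r = m + (r + 1) by ring, Real.sqrt_div (Nat.cast_nonneg N)]
    have h1 := mul_le_mul_of_nonneg_left (one_div_sqrt_succ_le m)
      (by positivity : (0 : ℝ) ≤ 3 * (2 * evalTime f + 4) * √N)
    push_cast
    rw [div_eq_mul_one_div]
    linarith

theorem exists_isSearch_exactLoop (f : Fin N → Timed Bool) (r n : ℕ) :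
    ∃ δ, IsSearch (exactLoop f r n) (solutions f) δ ∧
      (0 < n → n ≤ (solutions f).card → (solutions f).card < n + r → δ = 0) := by
  induction r generalizing n with
  | zero => exact ⟨1, IsSearch.ret_none, by omega⟩
  | succ r ih =>
    obtain ⟨δ, hδ, h1⟩ := exists_isSearch_exactSearch f n
    obtain ⟨η, hη, h2⟩ := ih (n + 1)
    refine ⟨_, hδ.orElseRun hη, fun h3 h4 h5 => ?_⟩
    rcases h4.eq_or_lt with h6 | h6
    · rw [h1 h3 h6.symm, zero_mul]
    · rw [h2 (by omega) h6 (by omega), mul_zero]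

theorem time_trialLoop (f : Fin N → Timed Bool) {m : ℝ} (hm : 0 < m) (h1 : 1 ≤ m) (r : ℕ) :
    (trialLoop f m hm r).time ≤ r * (2 * (2 * evalTime f + 4) * m) := by
  induction r with
  | zero => simp [trialLoop]
  | succ r ih =>
    obtain ⟨δ, hδ, -⟩ := exists_isSearch_groverTrial f m hm
    refine (hδ.time_orElseRun_le (time_groverTrial_of_one_le f hm h1) ih).trans (le_of_eq ?_)
    push_cast
    ring

theorem exists_isSearch_trialLoop (f : Fin N → Timed Bool) {m : ℝ} (hm : 0 < m) (r : ℕ) :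
    ∃ δ, IsSearch (trialLoop f m hm r) (solutions f) δ ∧
      (0 < (solutions f).card → √(N / (solutions f).card) ≤ m → δ ≤ (3 / 4) ^ r) := by
  induction r with
  | zero => exact ⟨1, IsSearch.ret_none, fun _ _ => by simp⟩
  | succ r ih =>
    obtain ⟨δ, hδ, h1⟩ := exists_isSearch_groverTrial f m hm
    obtain ⟨η, hη, h2⟩ := ih
    refine ⟨_, hδ.orElseRun hη, fun h3 h4 => ?_⟩
    rw [pow_succ, mul_comm]
    exact mul_le_mul (h2 h3 h4) (h1 h3 h4) hδ.nonneg (by positivity)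

theorem bcwzThreshold_pos {εinv : ℝ} (h : 1 < εinv) : 0 < bcwzThreshold N εinv :=
  lt_min (Nat.ceil_pos.mpr (Real.logb_pos one_lt_two h)) (NeZero.pos N)

theorem bcwz_eq (f : Fin N → Timed Bool) {εinv : ℝ} (h : 0 < bcwzThreshold N εinv) :
    bcwz f εinv = (exactLoop f (bcwzThreshold N εinv) 1).orElseRun
      (trialLoop f (√((N : ℝ) / bcwzThreshold N εinv))
        (Real.sqrt_pos.mpr (div_pos (Nat.cast_pos.mpr (NeZero.pos N)) (Nat.cast_pos.mpr h)))
        (3 * bcwzThreshold N εinv)) := by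
  simp only [bcwz, dif_pos h]

theorem time_bcwz (f : Fin N → Timed Bool) {εinv : ℝ} (h : 1 < εinv) :
    (bcwz f εinv).time ≤ 12 * (2 * evalTime f + 4) * (√N * √(bcwzThreshold N εinv)) := by
  have h0 := bcwzThreshold_pos (N := N) h
  have hle : bcwzThreshold N εinv ≤ N := min_le_right _ _
  rw [bcwz_eq f h0]
  generalize bcwzThreshold N εinv = r at h0 hle
  obtain ⟨δ, hδ, -⟩ := exists_isSearch_exactLoop f r 1
  have hr0 : (0 : ℝ) < r := Nat.cast_pos.mpr h0
  have h1 : 1 ≤ √((N : ℝ) / r) := by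
    rw [Real.one_le_sqrt, one_le_div hr0]
    exact_mod_cast hle
  have h2 := time_exactLoop f r 0 (by omega)
  refine (hδ.time_orElseRun_le h2 (time_trialLoop f _ h1 (3 * r))).trans (le_of_eq ?_)
  have h3 : (r : ℝ) * √((N : ℝ) / r) = √N * √r := by
    rw [Real.sqrt_div (Nat.cast_nonneg N), mul_div_assoc', div_eq_iff (by positivity), mul_assoc,
      Real.mul_self_sqrt hr0.le, mul_comm]
  push_cast
  rw [Real.sqrt_zero]
  simp only [zero_add]
  linear_combination (6 * (2 * (evalTime f : ℝ) + 4)) * h3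

/-- Few solutions are caught by an exact search with the right count; with many, the range of the
trials is critical, and (3/4)³ · 2 = 27/32 < 1. -/
theorem exists_isSearch_bcwz (f : Fin N → Timed Bool) {εinv : ℝ} (h : 1 < εinv) :
    ∃ δ, IsSearch (bcwz f εinv) (solutions f) δ ∧
      (0 < (solutions f).card → δ * εinv ≤ 1) := by
  have h0 := bcwzThreshold_pos (N := N) h
  rw [bcwz_eq f h0]
  obtain ⟨δ, hδ, h1⟩ := exists_isSearch_exactLoop f (bcwzThreshold N εinv) 1
  obtain ⟨η, hη, h2⟩ := exists_isSearch_trialLoop f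
    (Real.sqrt_pos.mpr (div_pos (Nat.cast_pos.mpr (NeZero.pos N)) (Nat.cast_pos.mpr h0)))
    (3 * bcwzThreshold N εinv)
  refine ⟨_, hδ.orElseRun hη, fun ht => ?_⟩
  rcases le_or_gt (solutions f).card (bcwzThreshold N εinv) with h3 | h3
  · rw [h1 one_pos ht (by omega)]
    simp
  · have h4 : bcwzThreshold N εinv = ⌈Real.logb 2 εinv⌉₊ := by
      have := card_solutions_le f
      rw [bcwzThreshold] at h3 ⊢
      omega
    have h5 : η ≤ (3 / 4) ^ (3 * bcwzThreshold N εinv) := by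
      refine h2 ht (Real.sqrt_le_sqrt ?_)
      gcongr
    have h6 : εinv ≤ 2 ^ bcwzThreshold N εinv := by
      rw [h4, ← Real.rpow_natCast, ← Real.logb_le_iff_le_rpow one_lt_two (by linarith)]
      exact Nat.le_ceil _
    calc δ * η * εinv ≤ 1 * (3 / 4) ^ (3 * bcwzThreshold N εinv) * 2 ^ bcwzThreshold N εinv := by
          have := hδ.le_one
          have := hδ.nonneg
          have := hη.nonneg
          gcongr
      _ = (27 / 32) ^ bcwzThreshold N εinv := by
          rw [one_mul, pow_mul, ← mul_pow]
          norm_num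
      _ ≤ 1 := pow_le_one₀ (by norm_num) (by norm_num)

theorem exists_isSearch_findsol (f : Fin N → Timed Bool) {εinv : ℝ} (h : 1 < εinv) :
    ∃ δ, IsSearch (findsol f εinv) (solutions f) δ ∧
      (0 < (solutions f).card → δ * (solutions f).card ^ 2 * εinv ≤ 1 / 2) := by
  obtain ⟨δ, hδ, h1⟩ := exists_isSearch_bbht f
  obtain ⟨η, hη, h2⟩ := exists_isSearch_bcwz f h
  refine ⟨_, hδ.orElseRun (hδ.orElseRun hη), fun ht => ?_⟩
  have h3 := (h1 ht).1
  have h4 := h2 ht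
  have hδ0 := hδ.nonneg
  calc δ * (δ * η) * (solutions f).card ^ 2 * εinv
      = (δ * (solutions f).card) ^ 2 * (η * εinv) := by ring
    _ ≤ (16 / 49) ^ 2 * 1 := by
        have := mul_nonneg hη.nonneg (zero_le_one.trans h.le)
        gcongr
    _ ≤ 1 / 2 := by norm_num

theorem time_findsol (f : Fin N → Timed Bool) {εinv : ℝ} (h : 2 ≤ εinv) :
    (findsol f εinv).time ≤
      82 * (2 * evalTime f + 4) * (√N * √(Real.logb 2 εinv)) := by
  obtain ⟨δ, hδ, -⟩ := exists_isSearch_bbht f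
  have h1 := time_bbht f
  have h2 := hδ.time_orElseRun_le h1 (hδ.time_orElseRun_le h1 (time_bcwz f (one_lt_two.trans_le h)))
  have hL : 1 ≤ Real.logb 2 εinv := by
    rw [Real.le_logb_iff_rpow_le one_lt_two (by linarith)]
    simpa using h
  have hL' : 1 ≤ √(Real.logb 2 εinv) := Real.one_le_sqrt.mpr hL
  have hκ : (0 : ℝ) ≤ 2 * evalTime f + 4 := by positivity
  refine h2.trans ?_
  have h3 : 12 * (2 * evalTime f + 4) * (√N * √(bcwzThreshold N εinv)) ≤
      12 * (2 * evalTime f + 4) * (√N * (3 / 2 * √(Real.logb 2 εinv))) := by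
    gcongr
    exact sqrt_bcwzThreshold_le h
  have h4 : (2 * evalTime f + 4) * √N * 1 ≤
      (2 * evalTime f + 4) * √N * √(Real.logb 2 εinv) := by gcongr
  linarith

/-- BBHT itself gains the factor 1/√t. BCWZ does not, but it is reached with probability δ², and δ√t
≤ 1. The constant is 32 + 32 + 18. -/
theorem time_findsol_of_card_pos (f : Fin N → Timed Bool) {εinv : ℝ} (h : 2 ≤ εinv)
    (ht : 0 < (solutions f).card) :
    (findsol f εinv).time ≤
      82 * (2 * evalTime f + 4) * (√N * √(Real.logb 2 εinv)) / √(solutions f).card := by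
  obtain ⟨δ, hδ, hd⟩ := exists_isSearch_bbht f
  obtain ⟨h1, h2⟩ := hd ht
  rw [findsol, hδ.time_orElseRun, hδ.time_orElseRun]
  have hL : 1 ≤ Real.logb 2 εinv := by
    rw [Real.le_logb_iff_rpow_le one_lt_two (by linarith)]
    simpa using h
  have hL' : 1 ≤ √(Real.logb 2 εinv) := Real.one_le_sqrt.mpr hL
  obtain ⟨κ, hκ⟩ : ∃ κ : ℝ, κ = 2 * evalTime f + 4 := ⟨_, rfl⟩
  have hκ0 : 0 ≤ κ := by rw [hκ]; positivity
  have h3 : (bcwz f εinv).time ≤ 18 * κ * (√N * √(Real.logb 2 εinv)) := by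
    refine (time_bcwz f (by linarith)).trans ?_
    rw [← hκ]
    have : 12 * κ * (√N * √(bcwzThreshold N εinv)) ≤
        12 * κ * (√N * (3 / 2 * √(Real.logb 2 εinv))) := by
      gcongr
      exact sqrt_bcwzThreshold_le h
    linarith
  rw [← hκ] at h2 ⊢
  rw [Real.sqrt_div (Nat.cast_nonneg N), mul_div_assoc'] at h2
  set t := (solutions f).card
  have ht1 : (1 : ℝ) ≤ t := Nat.one_le_cast.mpr ht
  have hst : (1 : ℝ) ≤ √t := Real.one_le_sqrt.mpr ht1
  have hst' : √(t : ℝ) ≤ t := Real.sqrt_le_self_iff.mpr (Or.inr ht1)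
  have hδ0 := hδ.nonneg
  have hδ1 := hδ.le_one
  have hT0 := (bbht f).time_nonneg
  have hT1 := (bcwz f εinv).time_nonneg
  rw [le_div_iff₀ (by linarith)] at h2 ⊢
  have h4 : δ * (bbht f).time * √t ≤ (bbht f).time * √t := by
    gcongr
    exact mul_le_of_le_one_left hT0 hδ1
  have h5 : δ * √t ≤ 1 := by nlinarith
  have h6 : δ * (δ * (bcwz f εinv).time) * √t ≤ (bcwz f εinv).time := by
    calc δ * (δ * (bcwz f εinv).time) * √t = (δ * √t) * (δ * (bcwz f εinv).time) := by ring
      _ ≤ 1 * (1 * (bcwz f εinv).time) := by gcongr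
      _ = _ := by ring
  have h7 : κ * √N * 1 ≤ κ * √N * √(Real.logb 2 εinv) := by gcongr
  linarith

end Loops

/-! ### Minimum finding. -/

/-- In increasing order, the element at position k (from 0) has at most k strictly smaller ones;
ties only lower the ranks. -/
theorem sum_rank_le {ι κ : Type} [LinearOrder κ] (g : ι → κ) {φ : ℕ → ℝ} (hφ : Monotone φ)
    (S : Finset ι) :
    ∑ y ∈ S, φ (S.filter fun z => g z < g y).card ≤ ∑ k ∈ Finset.range S.card, φ k := by
  classical
  induction S using Finset.induction_on_max_value g with
  | empty => simp
  | insert a s ha hmax ih =>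
    rw [Finset.sum_insert ha, Finset.card_insert_of_notMem ha, Finset.sum_range_succ, add_comm]
    refine add_le_add (le_trans (le_of_eq ?_) ih) (hφ ?_)
    · refine Finset.sum_congr rfl fun y hy => ?_
      rw [Finset.filter_insert, if_neg (not_lt.mpr (hmax y hy))]
    · rw [Finset.filter_insert, if_neg (lt_irrefl _)]
      exact Finset.card_filter_le _ _

/-- This is the inequality that makes the potential 5 - 4/√(t+1) drop by 1/√t when averaged over the
ranks below t. -/
theorem div_sqrt_add_le_sum_one_div_sqrt (t : ℕ) :
    t / √((t : ℝ) + 1) + √t / 4 ≤ ∑ k ∈ Finset.range t, 1 / √((k : ℝ) + 1) := by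
  induction t with
  | zero => simp
  | succ t ih =>
    rw [Finset.sum_range_succ]
    push_cast
    obtain ⟨x, hx⟩ : ∃ x, x = √(t : ℝ) := ⟨_, rfl⟩
    obtain ⟨y, hy⟩ : ∃ y, y = √((t : ℝ) + 1) := ⟨_, rfl⟩
    obtain ⟨z, hz⟩ : ∃ z, z = √((t : ℝ) + 1 + 1) := ⟨_, rfl⟩
    have hx2 : x ^ 2 = t := by rw [hx]; exact Real.sq_sqrt (by positivity)
    have hy2 : y ^ 2 = t + 1 := by rw [hy]; exact Real.sq_sqrt (by positivity)
    have hz2 : z ^ 2 = t + 1 + 1 := by rw [hz]; exact Real.sq_sqrt (by positivity)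
    have hx0 : 0 ≤ x := hx ▸ Real.sqrt_nonneg _
    have hy0 : 0 < y := hy ▸ by positivity
    have hz0 : 0 < z := hz ▸ by positivity
    rw [← hx, ← hy] at ih
    rw [← hy, ← hz]
    -- The right side is y + x/4. The increase (y - x)/4 ≤ 1/(4y) is offset by (t+1)/z ≤ y - 1/(4y).
    suffices h : ((t : ℝ) + 1) / z + y / 4 ≤ t / y + x / 4 + 1 / y by linarith
    have ht0 : (0 : ℝ) ≤ t := Nat.cast_nonneg t
    have e1 : (t : ℝ) / y + 1 / y = y := by
      rw [← add_div, ← hy2, pow_two, mul_div_assoc, div_self hy0.ne', mul_one]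
    have h1 : y - x ≤ 1 / y := by
      rw [le_div_iff₀ hy0]
      nlinarith
    have h2 : ((t : ℝ) + 1) / z ≤ y - 1 / (4 * y) := by
      have h3 : y / z ≤ 1 - 1 / (2 * z ^ 2) := by
        have h4 : (y / z) ^ 2 = 1 - 1 / z ^ 2 := by
          rw [div_pow, eq_sub_iff_add_eq, ← add_div, div_eq_one_iff_eq (by positivity)]
          linarith
        have h5 : 1 / (2 * z ^ 2) = 1 / z ^ 2 / 2 := by field_simp
        have h6 : 1 / z ^ 2 ≤ 1 := by
          rw [div_le_one (by positivity)]
          linarith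
        rw [h5]
        nlinarith [sq_nonneg (1 / z ^ 2), div_pos hy0 hz0]
      have h7 : ((t : ℝ) + 1) / z = y * (y / z) := by rw [← hy2]; ring
      have h8 : 1 / (4 * y) ≤ y * (1 / (2 * z ^ 2)) := by
        rw [mul_one_div, div_le_div_iff₀ (by positivity) (by positivity)]
        nlinarith
      rw [h7]
      nlinarith
    have h9 : 1 / (4 * y) = 1 / y / 4 := by field_simp
    linarith

section MinFind

variable {N : ℕ} {κ : Type} [LinearOrder κ]

/-- The number of elements at which `F` is smaller than at `y`. -/
def rank (F : Fin N → Timed κ) (y : Fin N) : ℕ := (solutions (isBelow F (F y).val)).card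

theorem mem_solutions_isBelow (F : Fin N → Timed κ) (v : κ) (z : Fin N) :
    z ∈ solutions (isBelow F v) ↔ (F z).val < v := by
  simp [solutions, isBelow]

theorem evalTime_isBelow_le (F : Fin N → Timed κ) (v : κ) :
    evalTime (isBelow F v) ≤ evalTime F + 1 :=
  Finset.sup_le fun i _ => Nat.succ_le_succ (cost_le_evalTime F i)

theorem rank_eq_of_mem (F : Fin N → Timed κ) {y z : Fin N}
    (hz : z ∈ solutions (isBelow F (F y).val)) :
    rank F z = ((solutions (isBelow F (F y).val)).filter
      fun x => (F x).val < (F z).val).card := by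
  rw [rank]
  congr 1
  ext x
  rw [mem_solutions_isBelow] at hz
  simp only [Finset.mem_filter, mem_solutions_isBelow]
  exact ⟨fun h => ⟨h.trans hz, h⟩, fun h => h.2⟩

theorem rank_lt_of_mem (F : Fin N → Timed κ) {y z : Fin N}
    (hz : z ∈ solutions (isBelow F (F y).val)) : rank F z < rank F y := by
  rw [rank_eq_of_mem F hz, rank]
  refine Finset.card_lt_card (Finset.filter_ssubset.mpr ⟨z, hz, lt_irrefl _⟩)

theorem rank_lt (F : Fin N → Timed κ) (y : Fin N) : rank F y < N := by
  have h : solutions (isBelow F (F y).val) ⊂ Finset.univ := by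
    refine Finset.filter_ssubset.mpr ⟨y, Finset.mem_univ y, ?_⟩
    simp [isBelow]
  simpa [rank] using Finset.card_lt_card h

variable [NeZero N]

theorem ev_minfindLoop_succ (F : Fin N → Timed κ) (εinv : ℝ) (n : ℕ) (y : Fin N)
    (φ : Fin N → ℝ) :
    (minfindLoop F εinv (n + 1) y).ev φ = (findsol (isBelow F (F y).val) εinv).ev
      fun o => o.elim (φ y) fun y' => (minfindLoop F εinv n y').ev φ := by
  rw [minfindLoop, QProg.bind_eq, QProg.ev_tick_bind, QProg.bind_eq, QProg.ev_bind]
  congr 1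
  ext o
  cases o <;> rfl

theorem time_minfindLoop_succ (F : Fin N → Timed κ) (εinv : ℝ) (n : ℕ) (y : Fin N) :
    (minfindLoop F εinv (n + 1) y).time = ((F y).cost + 1) +
      ((findsol (isBelow F (F y).val) εinv).time + (findsol (isBelow F (F y).val) εinv).ev
        fun o => o.elim 0 fun y' => (minfindLoop F εinv n y').time) := by
  rw [minfindLoop, QProg.bind_eq, QProg.time_tick_bind, QProg.bind_eq, QProg.time_bind]
  push_cast
  congr 3
  ext o
  cases o <;> rfl

-- Either the search fails now, with probability at most ε/(2t²), or the rank falls to at most t - 1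
-- and induction gives ε(t-1)/t.
open Classical in
theorem minfindLoop_failure (F : Fin N → Timed κ) {εinv : ℝ} (h : 1 < εinv) (n : ℕ) (y : Fin N)
    (hn : rank F y < n) :
    (minfindLoop F εinv n y).ev (fun y' => if ∀ z, (F y').val ≤ (F z).val then 0 else 1) * εinv ≤
      rank F y / (rank F y + 1) := by
  induction n generalizing y with
  | zero => omega
  | succ n ih =>
    obtain ⟨δ, ⟨hδ0, r, hr, hδr, hev⟩, hδ⟩ :=
      exists_isSearch_findsol (isBelow F (F y).val) h
    rw [ev_minfindLoop_succ, hev]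
    change δ + r * (rank F y) = 1 at hδr
    change 0 < rank F y → δ * (rank F y) ^ 2 * εinv ≤ 1 / 2 at hδ
    simp only [Option.elim]
    rcases Nat.eq_zero_or_pos (rank F y) with h0 | h0
    · have hS : solutions (isBelow F (F y).val) = ∅ := Finset.card_eq_zero.mp h0
      have hy : ∀ z, (F y).val ≤ (F z).val := by
        intro z
        by_contra hz
        have := (mem_solutions_isBelow F (F y).val z).mpr (not_le.mp hz)
        simp [hS] at this
      rw [if_pos hy, hS, h0]
      simp
    · obtain ⟨t, ht⟩ : ∃ t : ℝ, t = rank F y := ⟨_, rfl⟩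
      have ht1 : 1 ≤ t := by rw [ht]; exact_mod_cast h0
      have hδ' := hδ h0
      rw [← ht] at hδ' hδr ⊢
      have hterm : ∀ z ∈ solutions (isBelow F (F y).val),
          (minfindLoop F εinv n z).ev
            (fun y' => if ∀ z, (F y').val ≤ (F z).val then 0 else 1) ≤ (t - 1) / t / εinv := by
        intro z hz
        have hlt := rank_lt_of_mem F hz
        rw [le_div_iff₀ (by linarith)]
        refine (ih z (by omega)).trans ?_
        have h1 : (rank F z : ℝ) + 1 ≤ t := by rw [ht]; exact_mod_cast hlt
        rw [div_le_div_iff₀ (by positivity) (by linarith)]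
        nlinarith
      have hsum := Finset.sum_le_sum hterm
      rw [Finset.sum_const, nsmul_eq_mul] at hsum
      change _ ≤ (rank F y : ℝ) * _ at hsum
      rw [← ht] at hsum
      have hfirst : δ * (if ∀ z, (F y).val ≤ (F z).val then 0 else 1) ≤ δ := by
        split_ifs <;> linarith
      have h2 : δ * εinv ≤ 1 / (2 * t ^ 2) := by
        rw [le_div_iff₀ (by positivity)]
        linarith
      have h3 : r * t ≤ 1 := by linarith
      have h4 : r * (t * ((t - 1) / t / εinv)) * εinv ≤ (t - 1) / t := by
        have : r * (t * ((t - 1) / t / εinv)) * εinv = (r * t) * ((t - 1) / t) := by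
          field_simp
        rw [this]
        exact mul_le_of_le_one_left (div_nonneg (by linarith) (by linarith)) h3
      -- Equivalent to 1/(2t²) ≤ 1/(t(t+1)), true for t ≥ 1.
      have h5 : 1 / (2 * t ^ 2) + (t - 1) / t ≤ t / (t + 1) := by
        rw [div_add_div _ _ (by positivity) (by positivity),
          div_le_div_iff₀ (by positivity) (by positivity)]
        nlinarith [pow_pos (show 0 < t by linarith) 2]
      have h6 : r * ∑ i ∈ solutions (isBelow F (F y).val), (minfindLoop F εinv n i).ev
          (fun y' => if ∀ z, (F y').val ≤ (F z).val then 0 else 1) ≤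
            r * (t * ((t - 1) / t / εinv)) := by gcongr
      have h7 : 0 < εinv := by linarith
      nlinarith

/-- At rank 0 the potential is 1, enough for the last, fruitless search. In `W`, 83 is 82 for
findsol plus 1 for evaluating `F y`, and 6 allows for the comparison in `isBelow`. -/
theorem time_minfindLoop (F : Fin N → Timed κ) {εinv : ℝ} (h : 2 ≤ εinv) {W : ℝ}
    (hW : W = 83 * (2 * evalTime F + 6) * (√N * √(Real.logb 2 εinv))) (n : ℕ) (y : Fin N) :
    (minfindLoop F εinv n y).time ≤ W * (5 - 4 / √((rank F y : ℝ) + 1)) := by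
  have hL : 1 ≤ Real.logb 2 εinv := by
    rw [Real.le_logb_iff_rpow_le one_lt_two (by linarith)]
    simpa using h
  have hL' : 1 ≤ √(Real.logb 2 εinv) := Real.one_le_sqrt.mpr hL
  have hW0 : 0 ≤ W := by rw [hW]; positivity
  have hmono : Monotone fun k : ℕ => W * (5 - 4 / √((k : ℝ) + 1)) := by
    intro a b hab
    have : (a : ℝ) ≤ b := Nat.cast_le.mpr hab
    dsimp only
    gcongr
  have hpos : ∀ k : ℕ, 0 ≤ W * (5 - 4 / √((k : ℝ) + 1)) := by
    intro k
    refine le_trans ?_ (hmono (Nat.zero_le k))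
    norm_num
    exact hW0
  induction n generalizing y with
  | zero =>
    simp only [minfindLoop, QProg.pure_eq, QProg.time_ret]
    exact hpos _
  | succ n ih =>
    obtain ⟨δ, ⟨hδ0, r, hr, hδr, hev⟩, -⟩ :=
      exists_isSearch_findsol (isBelow F (F y).val) (one_lt_two.trans_le h)
    rw [time_minfindLoop_succ, hev]
    simp only [Option.elim, mul_zero, zero_add]
    obtain ⟨M, hM⟩ : ∃ M, M = (2 * (evalTime F : ℝ) + 6) * (√N * √(Real.logb 2 εinv)) := ⟨_, rfl⟩
    have hWM : W = 83 * M := by rw [hW, hM]; ring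
    have hcost : ((F y).cost : ℝ) + 1 ≤ 2 * evalTime F + 6 := by
      have : ((F y).cost : ℝ) ≤ evalTime F := Nat.cast_le.mpr (cost_le_evalTime F y)
      have : (0 : ℝ) ≤ evalTime F := Nat.cast_nonneg _
      linarith
    have hE : 2 * (evalTime (isBelow F (F y).val) : ℝ) + 4 ≤ 2 * evalTime F + 6 := by
      have : (evalTime (isBelow F (F y).val) : ℝ) ≤ evalTime F + 1 := by
        exact_mod_cast evalTime_isBelow_le F _
      linarith
    have hfM : 82 * (2 * (evalTime (isBelow F (F y).val) : ℝ) + 4) *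
        (√N * √(Real.logb 2 εinv)) ≤ 82 * M := by
      rw [hM, mul_assoc]
      gcongr
    have hN1 : (1 : ℝ) ≤ √N := Real.one_le_sqrt.mpr (by exact_mod_cast NeZero.pos N)
    rcases Nat.eq_zero_or_pos (rank F y) with h0 | h0
    · have hS : solutions (isBelow F (F y).val) = ∅ := Finset.card_eq_zero.mp h0
      have h1 := time_findsol (isBelow F (F y).val) h
      have h2 : (2 * (evalTime F : ℝ) + 6) * (1 * 1) ≤ M := by
        rw [hM]; gcongr
      rw [h0, hS]
      norm_num
      linarith
    · have h1 := time_findsol_of_card_pos (isBelow F (F y).val) h h0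
      change _ ≤ _ / √(rank F y : ℝ) at h1
      change δ + r * (rank F y) = 1 at hδr
      have hsum : ∑ i ∈ solutions (isBelow F (F y).val), (minfindLoop F εinv n i).time ≤
          ∑ k ∈ Finset.range (rank F y), W * (5 - 4 / √((k : ℝ) + 1)) := by
        refine (Finset.sum_le_sum fun i hi => ?_).trans
          (sum_rank_le (fun z => (F z).val) hmono (solutions (isBelow F (F y).val)))
        rw [← rank_eq_of_mem F hi]
        exact ih i
      have hrt := div_sqrt_add_le_sum_one_div_sqrt (rank F y)
      have hlt : (rank F y : ℝ) ≤ N := Nat.cast_le.mpr (rank_lt F y).le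
      have ht1 : (1 : ℝ) ≤ rank F y := Nat.one_le_cast.mpr h0
      have hsums : ∑ k ∈ Finset.range (rank F y), W * (5 - 4 / √((k : ℝ) + 1)) =
          W * (5 * rank F y - 4 * ∑ k ∈ Finset.range (rank F y), 1 / √((k : ℝ) + 1)) := by
        rw [← Finset.mul_sum, Finset.sum_sub_distrib, Finset.sum_const, Finset.card_range,
          nsmul_eq_mul, Finset.mul_sum]
        simp only [mul_one_div]
        ring
      rw [hsums] at hsum
      generalize (rank F y : ℝ) = t at *
      generalize ∑ k ∈ Finset.range (rank F y), 1 / √((k : ℝ) + 1) = H at *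
      obtain ⟨s, hs⟩ : ∃ s, s = √t := ⟨_, rfl⟩
      have hs1 : 1 ≤ s := hs ▸ Real.one_le_sqrt.mpr ht1
      have hst : t = s * s := by rw [hs, Real.mul_self_sqrt (by linarith)]
      have hsN : s ≤ √N := hs ▸ Real.sqrt_le_sqrt hlt
      rw [← hs] at h1 hrt
      have h2 : 2 * (evalTime F : ℝ) + 6 ≤ M / s := by
        rw [le_div_iff₀ (by linarith), hM]
        have : s * 1 ≤ √N * √(Real.logb 2 εinv) := by gcongr
        nlinarith [(Nat.cast_nonneg (evalTime F) : (0 : ℝ) ≤ _)]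
      have h3 : (findsol (isBelow F (F y).val) εinv).time ≤ 82 * M / s :=
        h1.trans (by gcongr)
      have hrt1 : r ≤ 1 / t := by
        rw [le_div_iff₀ (by linarith)]
        linarith
      have h4 : W * (5 * t - 4 * H) ≤ W * (5 * t - 4 * (t / √(t + 1) + s / 4)) := by gcongr
      have h5 : 0 ≤ ∑ i ∈ solutions (isBelow F (F y).val), (minfindLoop F εinv n i).time :=
        Finset.sum_nonneg fun i _ => QProg.time_nonneg _
      have h6 : r * ∑ i ∈ solutions (isBelow F (F y).val), (minfindLoop F εinv n i).time ≤
          1 / t * (W * (5 * t - 4 * (t / √(t + 1) + s / 4))) :=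
        mul_le_mul hrt1 (hsum.trans h4) h5 (by positivity)
      have h7 : 1 / t * (W * (5 * t - 4 * (t / √(t + 1) + s / 4))) =
          W * (5 - 4 / √(t + 1)) - W / s := by
        have e1 : 1 / t * (5 * t) = 5 := by field_simp
        have e2 : 1 / t * (t / √(t + 1)) = 1 / √(t + 1) := by field_simp
        have e3 : 1 / t * s = 1 / s := by rw [hst]; field_simp
        linear_combination W * e1 - 4 * W * e2 - W * e3
      -- The drop of the potential pays for the evaluation and the search.
      have h8 : W / s = M / s + 82 * M / s := by rw [hWM]; ring
      linarith

end MinFind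

/-- The outcomes that a search for a minimum of `F` should have. -/
def IsMinOutcome {N : ℕ} {κ : Type} [LinearOrder κ] (F : Fin N → Timed κ) :
    Option (Fin N) → Prop
  | none => N = 0
  | some y => ∀ z, (F y).val ≤ (F z).val

section MinFind

variable {N : ℕ} {κ : Type} [LinearOrder κ]

open Classical in
theorem minfind_failure (F : Fin N → Timed κ) {εinv : ℝ} (h : 1 < εinv) :
    (minfind F εinv).ev (fun o => if IsMinOutcome F o then 0 else 1) ≤ 1 / εinv := by
  rcases Nat.eq_zero_or_pos N with rfl | hN
  · have : (minfind F εinv).ev (fun o => if IsMinOutcome F o then 0 else 1) = 0 := by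
      simp [minfind, IsMinOutcome]
    rw [this]
    positivity
  · have : NeZero N := ⟨hN.ne'⟩
    have e : (minfind F εinv).ev (fun o => if IsMinOutcome F o then 0 else 1) =
        ((QProg.toss N hN QProg.ret).bind fun y => minfindLoop F εinv N y).ev
          (fun y' => if ∀ z, (F y').val ≤ (F z).val then 0 else 1) := by
      have hite : (fun y' => if ∀ z, (F y').val ≤ (F z).val then (0 : ℝ) else 1) =
          fun y' => if IsMinOutcome F (some y') then 0 else 1 := by
        ext y'
        by_cases h : ∀ z, (F y').val ≤ (F z).val
        · rw [if_pos h, if_pos (show IsMinOutcome F (some y') from h)]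
        · rw [if_neg h, if_neg (show ¬ IsMinOutcome F (some y') from h)]
      rw [hite]
      simp only [minfind, dif_neg hN.ne', QProg.bind_eq, QProg.ev_bind, QProg.pure_eq,
        QProg.ev_ret]
      rfl
    rw [e, QProg.ev_bind]
    refine QProg.ev_le _ fun y => ?_
    rw [le_div_iff₀ (by linarith)]
    refine (minfindLoop_failure F h N y (rank_lt F y)).trans ?_
    rw [div_le_one (by positivity)]
    linarith

theorem time_minfind (F : Fin N → Timed κ) {εinv : ℝ} (h : 2 ≤ εinv) :
    (minfind F εinv).time ≤
      2 + 415 * (2 * evalTime F + 6) * (√N * √(Real.logb 2 εinv)) := by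
  rcases Nat.eq_zero_or_pos N with rfl | hN
  · simp [minfind]
  · have : NeZero N := ⟨hN.ne'⟩
    have e : (minfind F εinv).time = (1 : ℕ) +
        ((QProg.toss N hN QProg.ret).bind fun y => minfindLoop F εinv N y).time := by
      simp only [minfind, dif_neg hN.ne', QProg.bind_eq, QProg.time_bind, QProg.pure_eq,
        QProg.time_ret, QProg.ev_const, add_zero]
      simp [QProg.tick, QProg.time, QProg.ev]
    have h1 : ((QProg.toss N hN QProg.ret).bind fun y => minfindLoop F εinv N y).time ≤
        1 + 83 * (2 * evalTime F + 6) * (√N * √(Real.logb 2 εinv)) * 5 := by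
      refine QProg.time_bind_le (by simp [QProg.time]) fun y => ?_
      refine (time_minfindLoop F h rfl N y).trans ?_
      gcongr
      have : 0 ≤ 4 / √((rank F y : ℝ) + 1) := by positivity
      linarith
    rw [e]
    push_cast
    linarith

end MinFind

/-! ### Dynamic programming for the coin changer. -/

section Coins

variable {C : ℕ} (V : Fin C → ℕ)

theorem minCoins_le (c : Fin C → ℕ) : minCoins V (∑ i, c i * V i) ≤ ((∑ i, c i : ℕ) : ℕ∞) :=
  iInf₂_le (f := fun (c' : Fin C → ℕ) (_ : ∑ i, c' i * V i = ∑ i, c i * V i) =>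
    ((∑ i, c' i : ℕ) : ℕ∞)) c rfl

theorem minCoins_zero : minCoins V 0 = 0 := by
  simpa using minCoins_le V 0

theorem minCoins_eq_top_or_exists (m : ℕ) : minCoins V m = ⊤ ∨
    ∃ c : Fin C → ℕ, ∑ i, c i * V i = m ∧ minCoins V m = ((∑ i, c i : ℕ) : ℕ∞) := by
  rw [minCoins, iInf_subtype']
  rcases isEmpty_or_nonempty {c : Fin C → ℕ // ∑ i, c i * V i = m} with h | h
  · exact Or.inl ((iInf_of_isEmpty _).trans sInf_empty)
  · obtain ⟨c, hc⟩ := csInf_mem (Set.range_nonempty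
      fun c : {c : Fin C → ℕ // ∑ i, c i * V i = m} => ((∑ i, c.1 i : ℕ) : ℕ∞))
    exact Or.inr ⟨c.1, c.2, hc.symm⟩

theorem minCoins_add_le (m : ℕ) (i : Fin C) : minCoins V (m + V i) ≤ 1 + minCoins V m := by
  rcases minCoins_eq_top_or_exists V m with h | ⟨c, hc, h⟩
  · simp [h]
  · have h1 := minCoins_le V (c + Pi.single i 1)
    simp only [Pi.add_apply, add_mul, Finset.sum_add_distrib, hc, Pi.single_apply, ite_mul,
      one_mul, zero_mul, Finset.sum_ite_eq', Finset.mem_univ, if_true] at h1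
    rw [h, add_comm 1]
    exact_mod_cast h1

/-- Remove one coin of positive value that is used; zero coins cannot make progress. -/
theorem exists_one_add_minCoins_le (c : Fin C → ℕ) (h : 0 < ∑ i, c i * V i) :
    ∃ i, 0 < V i ∧ V i ≤ ∑ i, c i * V i ∧
      1 + minCoins V (∑ i, c i * V i - V i) ≤ ((∑ i, c i : ℕ) : ℕ∞) := by
  obtain ⟨i, -, hi⟩ := Finset.exists_ne_zero_of_sum_ne_zero h.ne'
  obtain ⟨hci, hVi⟩ := mul_ne_zero_iff.mp hi
  obtain ⟨b, rfl⟩ : ∃ b : Fin C → ℕ, c = b + Pi.single i 1 := by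
    refine ⟨fun k => c k - if k = i then 1 else 0, funext fun k => ?_⟩
    rcases eq_or_ne k i with rfl | hk
    · simp; omega
    · simp [hk]
  have e : ∑ k, (b + Pi.single i 1 : Fin C → ℕ) k * V k = ∑ k, b k * V k + V i := by
    simp [add_mul, Finset.sum_add_distrib, Pi.single_apply]
  have e' : ∑ k, (b + Pi.single i 1 : Fin C → ℕ) k = ∑ k, b k + 1 := by
    simp [Finset.sum_add_distrib]
  refine ⟨i, Nat.pos_of_ne_zero hVi, by omega, ?_⟩
  rw [e, e', Nat.add_sub_cancel, add_comm 1]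
  exact_mod_cast add_le_add (minCoins_le V b) le_rfl

/-- The table `T` is right in the cells `0, …, d` and is still `⊤` in the others. -/
def IsTable (d : ℕ) (T : ℕ → ℕ∞) : Prop :=
  ∀ j, T j = if j ≤ d then minCoins V j else ⊤

variable {V}

theorem IsTable.minCoins_succ {d : ℕ} {T : ℕ → ℕ∞} (hT : IsTable V d T) :
    minCoins V (d + 1) = ⨅ i, (coinValue V T (d + 1) i).val := by
  refine le_antisymm (le_iInf fun i => ?_) (le_iInf₂ fun c hc => ?_)
  · rw [coinValue]
    split_ifs with h
    · rw [hT]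
      split_ifs with h'
      -- The other case is a coin of value 0: it reads the cell being filled, still `⊤`, and so does
      -- no harm.
      · have := minCoins_add_le V (d + 1 - V i) i
        rwa [Nat.sub_add_cancel h] at this
      · simp
    · exact le_top
  · obtain ⟨i, h0, h1, h2⟩ := exists_one_add_minCoins_le V c (by omega)
    rw [hc] at h1 h2
    refine (iInf_le _ i).trans ?_
    rwa [coinValue, if_pos h1, hT, if_pos (by omega)]

/-- The table after the search for the entry `d` had the outcome `o`. -/
def updateTable (V : Fin C → ℕ) (T : ℕ → ℕ∞) (d : ℕ) (o : Option (Fin C)) : ℕ → ℕ∞ :=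
  o.elim T fun i => if V i ≤ d then Function.update T d (1 + T (d - V i)) else T

theorem IsTable.updateTable {d : ℕ} {T : ℕ → ℕ∞} (hT : IsTable V d T) {o : Option (Fin C)}
    (ho : IsMinOutcome (coinValue V T (d + 1)) o) :
    IsTable V (d + 1) (updateTable V T (d + 1) o) := by
  have hinf := hT.minCoins_succ
  have keep : minCoins V (d + 1) = ⊤ → IsTable V (d + 1) T := by
    intro htop j
    rw [hT]
    rcases lt_trichotomy j (d + 1) with h | rfl | h
    · rw [if_pos (by omega), if_pos h.le]
    · rw [if_neg (by omega), if_pos le_rfl, htop]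
    · rw [if_neg (by omega), if_neg (by omega)]
  cases o with
  | none =>
    obtain rfl : C = 0 := ho
    exact keep (by rw [hinf, iInf_of_isEmpty, sInf_empty])
  | some i =>
    have hi : minCoins V (d + 1) = (coinValue V T (d + 1) i).val :=
      hinf.trans (le_antisymm (iInf_le _ i) (le_iInf ho))
    simp only [_root_.updateTable, Option.elim]
    rw [coinValue] at hi
    split_ifs at hi ⊢ with h
    · intro j
      rcases eq_or_ne j (d + 1) with rfl | hj
      · rw [Function.update_self, if_pos le_rfl, hi]
      · rw [Function.update_of_ne hj, hT]
        congr 1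
        exact propext ⟨fun h => by omega, fun h => by omega⟩
    · exact keep hi

theorem evalTime_coinValue_le (T : ℕ → ℕ∞) (d : ℕ) : evalTime (coinValue V T d) ≤ 5 := by
  refine Finset.sup_le fun i _ => ?_
  rw [coinValue]
  split_ifs <;> simp

theorem ev_coinTable_succ (D : ℕ) (εinv : ℝ) (d : ℕ) (φ : (ℕ → ℕ∞) → ℝ) :
    (coinTable V D εinv (d + 1)).ev φ = (coinTable V D εinv d).ev fun T =>
      (minfind (coinValue V T (d + 1)) εinv).ev fun o => φ (updateTable V T (d + 1) o) := by
  simp only [coinTable, QProg.bind_eq, QProg.ev_bind]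
  congr 1
  ext T
  change (minfind (coinValue V T (d + 1)) εinv).ev _ = _
  congr 1
  ext o
  cases o <;> rfl

-- A union bound over the entries. The condition on `εinv` is dropped at `d = 0`, since for D = 0
-- the parameter D ε⁻¹ is 0.
open Classical in
theorem coinTable_failure (D : ℕ) {εinv : ℝ} (d : ℕ) (h : 0 < d → 1 < εinv) :
    (coinTable V D εinv d).ev (fun T => if IsTable V d T then 0 else 1) ≤ d * (1 / εinv) := by
  induction d with
  | zero =>
    have : IsTable V 0 fun j => if j = 0 then 0 else ⊤ := by
      intro j
      rcases Nat.eq_zero_or_pos j with rfl | hj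
      · simp [minCoins_zero]
      · simp [hj.ne']
    change (if IsTable V 0 (fun j => if j = 0 then 0 else ⊤) then (0 : ℝ) else 1) ≤ _
    rw [if_pos this]
    simp
  | succ d ih =>
    have h' := h d.succ_pos
    have h0 : 0 ≤ 1 / εinv := by positivity
    rw [ev_coinTable_succ]
    have h1 : ∀ T, (minfind (coinValue V T (d + 1)) εinv).ev (fun o =>
        if IsTable V (d + 1) (updateTable V T (d + 1) o) then 0 else 1) ≤
          (if IsTable V d T then 0 else 1) + 1 / εinv := by
      intro T
      by_cases hT : IsTable V d T
      · rw [if_pos hT, zero_add]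
        refine (QProg.ev_mono _ fun o => ?_).trans (minfind_failure (coinValue V T (d + 1)) h')
        by_cases ho : IsMinOutcome (coinValue V T (d + 1)) o
        · rw [if_pos ho, if_pos (hT.updateTable ho)]
        · rw [if_neg ho]
          split_ifs <;> norm_num
      · rw [if_neg hT]
        refine (QProg.ev_le (x := 1) _ fun o => ?_).trans (by linarith)
        split_ifs <;> norm_num
    refine (QProg.ev_mono _ h1).trans ?_
    rw [QProg.ev_add, QProg.ev_const]
    have := ih fun _ => h'
    push_cast
    linarith

theorem time_coinTable (D : ℕ) {εinv : ℝ} (h : 2 ≤ εinv) (d : ℕ) :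
    (coinTable V D εinv d).time ≤
      (D + 1) + d * (9 + 6640 * (√C * √(Real.logb 2 εinv))) := by
  induction d with
  | zero => simp [coinTable, QProg.tick, QProg.time, QProg.bind]
  | succ d ih =>
    rw [coinTable, QProg.bind_eq]
    refine (QProg.time_bind_le ih fun T => (?_ : _ ≤ 9 + 6640 * (√C * √(Real.logb 2 εinv)))).trans
      (le_of_eq (by push_cast; ring))
    rw [QProg.bind_eq, QProg.time_tick_bind, QProg.bind_eq]
    have h1 : (minfind (coinValue V T (d + 1)) εinv).time ≤
        2 + 6640 * (√C * √(Real.logb 2 εinv)) := by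
      refine (time_minfind (coinValue V T (d + 1)) h).trans ?_
      have : (evalTime (coinValue V T (d + 1)) : ℝ) ≤ 5 := by
        exact_mod_cast evalTime_coinValue_le T (d + 1)
      have h2 : (2 * (evalTime (coinValue V T (d + 1)) : ℝ) + 6) ≤ 16 := by linarith
      have h3 : 415 * (2 * (evalTime (coinValue V T (d + 1)) : ℝ) + 6) *
          (√C * √(Real.logb 2 εinv)) ≤ 415 * 16 * (√C * √(Real.logb 2 εinv)) := by gcongr
      linarith
    refine (add_le_add le_rfl (QProg.time_bind_le (y := 6) h1 fun o => ?_)).trans ?_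
    · cases o <;> simp
    · push_cast
      linarith

theorem time_coinchange (V : Fin C → ℕ) {D : ℕ} {ε : ℝ} (hC : 1 ≤ C) (hD : 1 ≤ D)
    (h : 2 ≤ D * ε⁻¹) :
    (coinchange V D ε).time ≤ 6652 * (D * √(C * Real.logb 2 (D * ε⁻¹))) := by
  have hL : 1 ≤ Real.logb 2 (D * ε⁻¹) := by
    rw [Real.le_logb_iff_rpow_le one_lt_two (by linarith)]
    simpa using h
  have hX : 1 ≤ √(C * Real.logb 2 (D * ε⁻¹)) := by
    have : (1 : ℝ) ≤ C := Nat.one_le_cast.mpr hC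
    exact Real.one_le_sqrt.mpr (one_le_mul_of_one_le_of_one_le this hL)
  have hD' : (1 : ℝ) ≤ D := Nat.one_le_cast.mpr hD
  have h1 := QProg.time_bind_le (y := 1) (time_coinTable (V := V) D h D)
    (g := fun T => (do QProg.tick 1; return T D : QProg ℕ∞)) (by intro T; simp)
  rw [← Real.sqrt_mul (Nat.cast_nonneg C)] at h1
  refine h1.trans ?_
  -- The lower-order terms are at most 12 D, whence 6652 = 6640 + 12.
  have h2 : (D : ℝ) * 1 ≤ D * √(C * Real.logb 2 (D * ε⁻¹)) := by gcongr
  nlinarith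

open Classical in
theorem coinchange_success (V : Fin C → ℕ) (D : ℕ) {ε : ℝ} (h0 : 0 < ε) (h1 : ε < 1) :
    1 - ε ≤ (coinchange V D ε).ev fun x => if x = minCoins V D then 1 else 0 := by
  have e : (coinchange V D ε).ev (fun x => if x = minCoins V D then 1 else 0) =
      (coinTable V D (D * ε⁻¹) D).ev fun T => if T D = minCoins V D then 1 else 0 := by
    rw [coinchange, QProg.bind_eq, QProg.ev_bind]
    rfl
  have hε : 1 < ε⁻¹ := (one_lt_inv₀ h0).mpr h1
  have h2 := coinTable_failure (V := V) D (εinv := D * ε⁻¹) D fun hD => by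
    have : (1 : ℝ) ≤ D := Nat.one_le_cast.mpr hD
    nlinarith
  have h3 : (D : ℝ) * (1 / (D * ε⁻¹)) ≤ ε := by
    rcases Nat.eq_zero_or_pos D with rfl | hD
    · simpa using h0.le
    · have : (D : ℝ) ≠ 0 := Nat.cast_ne_zero.mpr hD.ne'
      refine le_of_eq ?_
      field_simp
  have h4 : (coinTable V D (D * ε⁻¹) D).ev (fun _ => 1) ≤
      (coinTable V D (D * ε⁻¹) D).ev fun T =>
        (if T D = minCoins V D then 1 else 0) + if IsTable V D T then 0 else 1 := by
    refine QProg.ev_mono _ fun T => ?_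
    by_cases hT : IsTable V D T
    · rw [if_pos hT, if_pos (by simpa using hT D)]
      norm_num
    · rw [if_neg hT]
      split_ifs <;> norm_num
  rw [QProg.ev_const, QProg.ev_add] at h4
  rw [e]
  linarith

end Coins

theorem theorem11 :
    -- correctness, with failure probability at most `ε`
    (∀ (C : ℕ) (V : Fin C → ℕ) (D : ℕ) (ε : ℝ), 0 < ε → ε < 1 →
      ENNReal.ofReal (1 - ε) ≤ (coinchange V D ε).output (minCoins V D)) ∧
    -- running time for an arbitrary failure probability
    (∃ K : ℝ, 0 < K ∧ ∀ (C : ℕ) (V : Fin C → ℕ) (D : ℕ) (ε : ℝ), 0 < ε → ε < 1 →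
      1 ≤ C → 1 ≤ D → 2 ≤ D * ε⁻¹ →
      (coinchange V D ε).expectedTime ≤
        ENNReal.ofReal (K * (D * √(C * Real.logb 2 (D * ε⁻¹))))) ∧
    -- running time when the inverse of the failure probability is polynomially bounded
    (∀ a : ℕ, ∃ K : ℝ, 0 < K ∧ ∀ (C : ℕ) (V : Fin C → ℕ) (D : ℕ) (ε : ℝ), 0 < ε → ε < 1 →
      1 ≤ C → 2 ≤ D → ε⁻¹ ≤ (D : ℝ) ^ a →
      (coinchange V D ε).expectedTime ≤
        ENNReal.ofReal (K * (D * √(C * Real.logb 2 D)))) := by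
  refine ⟨fun C V D ε h0 h1 => ?_, ⟨6652, by norm_num, fun C V D ε h0 h1 hC hD h => ?_⟩,
    fun a => ⟨6652 * √(a + 1), by positivity, fun C V D ε h0 h1 hC hD h => ?_⟩⟩
  · rw [QProg.output_apply]
    refine ENNReal.ofReal_le_ofReal ((coinchange_success V D h0 h1).trans_eq ?_)
    congr!
  · rw [QProg.expectedTime_eq]
    exact ENNReal.ofReal_le_ofReal (time_coinchange V hC hD h)
  · rw [QProg.expectedTime_eq]
    refine ENNReal.ofReal_le_ofReal ?_
    have hε : 1 < ε⁻¹ := (one_lt_inv₀ h0).mpr h1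
    have hD2 : (2 : ℝ) ≤ D := by exact_mod_cast hD
    have hle : Real.logb 2 (D * ε⁻¹) ≤ (a + 1) * Real.logb 2 D := by
      -- The logarithm grows by at most the factor a + 1, whose root enters the constant.
      have h3 : (D : ℝ) * ε⁻¹ ≤ D ^ (a + 1) := by
        rw [pow_succ, mul_comm]
        gcongr
      refine (Real.logb_le_logb_of_le one_lt_two (by positivity) h3).trans (le_of_eq ?_)
      rw [Real.logb_pow]
      push_cast
      ring
    refine (time_coinchange V hC (by omega) (by nlinarith)).trans ?_
    calc 6652 * (D * √(C * Real.logb 2 (D * ε⁻¹)))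
        ≤ 6652 * (D * √((a + 1) * (C * Real.logb 2 D))) := by
          gcongr 6652 * (D * √?_)
          rw [mul_left_comm]
          gcongr
      _ = 6652 * √(a + 1) * (D * √(C * Real.logb 2 D)) := by
          rw [Real.sqrt_mul (by positivity)]
          ring
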